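/- Let $G$ be a connected complex Lie group whose Lie algebra $\mathfrak g$ is simple of type $ADE$. Fix a Cartan subalgebra $\mathfrak h$ and a base of the root system $\Phi=\Phi^+\cup\Phi^-$, and let $B\subset G$ be the Borel subgroup with Lie algebra $\mathfrak b=\mathfrak h\oplus\bigoplus_{\alpha\in\Phi^-}\mathfrak g_\alpha$. For a weight $\lambda$, let $L_\lambda$ be the holomorphic line bundle over $G/B$ associated with the corresponding character of $B$. Let $0=F_0\subset F_1\subset\dots\subset F_N=\mathfrak g$, $N=\dim\mathfrak g$, be a complete filtration by $B$-submodules, let $e_1,\dots,e_N$ be a basis of $\mathfrak g$ consisting of weight vectors with $F_k=\langle e_1,\dots,e_k\rangle$, and let $\lambda_i$ be the weight of $e_i$, so that $F_i/F_{i-1}$ gives the line bundle $L_{\lambda_i}$. The sum $\bigoplus_i L_{\lambda_i}$ carries the direct-sum holomorphic structure $\overline\partial_0$ and, through the basis $e_i$, the Lie bracket of $\mathfrak g$ on its fibres. Use any $C^\infty$ isomorphism of Lie algebra bundles $G\times\mathfrak g/B\cong\bigoplus_i L_{\lambda_i}$ that splits the filtration of $G\times\mathfrak g/B$ by the subbundles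 $G\times F_k/B$ (that is, it preserves the filtrations and induces the identity on the successive quotients $L_{\lambda_i}$) to write operators on $G\times\mathfrak g/B$ as matrices. Let $\overline\partial_\varphi:\Omega^{0,0}(G/B,G\times\mathfrak g/B)\to\Omega^{0,1}(G/B,G\times\mathfrak g/B)$ be an operator given by an upper-triangular matrix with all diagonal entries $\overline\partial$ and with entries $\varphi_{ij}\in\Omega^{0,1}(G/B,L_{\lambda_i}\otimes L_{\lambda_j}^*)$ for $i<j$ (integrability $\overline\partial_\varphi^2=0$ is not required). Then $\overline\partial_\varphi[\,\cdot\,,\cdot\,]=0$, i.e. $\overline\partial_\varphi[s,t]=[\overline\partial_\varphi s,t]+[s,\overline\partial_\varphi t]$ for all smooth sections $s,t$ of $G\times\mathfrak g/B$, if and only if there are forms $\varphi_\alpha\in\Omega^{0,1}(G/B,L_\alpha)$, $\alpha\in\Phi^-$, where $L_\alpha\subset\bigoplus_i L_{\lambda_i}$ is the line subbundle with fibre $\mathfrak g_\alpha$, such that $$\overline\partial_\varphi=\overline\partial_0+\sum_{\alpha\in\Phi^-}\operatorname{ad}(\varphi_\alpha).$$ -/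

import Mathlib

open scoped Manifold ContDiff

noncomputable section

namespace FlagBundle

section LieAlgebraOfG

variable (E : Type*) [NormedAddCommGroup E] [NormedSpace ℂ E]
  (G : Type*) [TopologicalSpace G] [ChartedSpace E G] [Group G]

/-- The Lie algebra `𝔤 = T₁G` of the complex Lie group `G`. -/
abbrev LieAlg : Type _ := GroupLieAlgebra 𝓘(ℂ, E) G

instance instFiniteDimensionalLieAlg [FiniteDimensional ℂ E] :
    FiniteDimensional ℂ (LieAlg E G) :=
  inferInstanceAs (FiniteDimensional ℂ E)

end LieAlgebraOfG

section AdjointAction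

variable {E : Type*} [NormedAddCommGroup E] [NormedSpace ℂ E]
  {G : Type*} [TopologicalSpace G] [ChartedSpace E G] [Group G]

/-- The adjoint representation: `Ad p` is the derivative at `1` of `y ↦ p y p⁻¹`. -/
def Ad (p : G) : LieAlg E G →ₗ[ℂ] LieAlg E G :=
  (mfderiv 𝓘(ℂ, E) 𝓘(ℂ, E) (fun y : G => p * y * p⁻¹) 1).toLinearMap

theorem Ad_one : Ad (1 : G) = (LinearMap.id : LieAlg E G →ₗ[ℂ] LieAlg E G) := by
  have h : (fun y : G => (1 : G) * y * (1 : G)⁻¹) = id := by ext y; simp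
  unfold Ad
  ext x
  have h2 : (mfderiv 𝓘(ℂ, E) 𝓘(ℂ, E) (fun y : G => (1 : G) * y * (1 : G)⁻¹) 1 : E →L[ℂ] E)
      = ContinuousLinearMap.id ℂ E := by
    rw [h]; exact mfderiv_id
  exact congrArg (fun f : E →L[ℂ] E => f x) h2

variable [LieGroup 𝓘(ℂ, E) ω G]

theorem mdiff_conj (p y : G) : MDifferentiableAt 𝓘(ℂ, E) 𝓘(ℂ, E) (fun y : G => p * y * p⁻¹) y := by
  have h : ContMDiff 𝓘(ℂ, E) 𝓘(ℂ, E) ω (fun y : G => p * y * p⁻¹) :=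
    (contMDiff_mul_right (I := 𝓘(ℂ, E)) (n := ω) (a := p⁻¹)).comp
      (contMDiff_mul_left (I := 𝓘(ℂ, E)) (n := ω) (a := p))
  exact h.mdifferentiableAt (by simp)

theorem Ad_mul (p q : G) (x : LieAlg E G) : Ad (p * q) x = Ad p (Ad q x) := by
  have h : (fun y : G => (p * q) * y * (p * q)⁻¹)
      = (fun y : G => p * y * p⁻¹) ∘ (fun y : G => q * y * q⁻¹) := by
    ext y; simp [mul_assoc]
  have h1 : q * 1 * q⁻¹ = 1 := by simp
  have key := mfderiv_comp (I := 𝓘(ℂ, E)) (I' := 𝓘(ℂ, E)) (I'' := 𝓘(ℂ, E)) (1 : G)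
    (mdiff_conj p (q * 1 * q⁻¹)) (mdiff_conj q 1)
  have key2 : (mfderiv 𝓘(ℂ, E) 𝓘(ℂ, E) (fun y : G => (p * q) * y * (p * q)⁻¹) 1 : E →L[ℂ] E) x =
     (mfderiv 𝓘(ℂ, E) 𝓘(ℂ, E) (fun y : G => p * y * p⁻¹) (q * 1 * q⁻¹) : E →L[ℂ] E)
      ((mfderiv 𝓘(ℂ, E) 𝓘(ℂ, E) (fun y : G => q * y * q⁻¹) 1 : E →L[ℂ] E) x) := by
    rw [h]
    exact congrArg (fun f : E →L[ℂ] E => f x) key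
  rw [h1] at key2
  exact key2

theorem mfderiv_conj_inv (p y : G) :
    (mfderiv 𝓘(ℂ, E) 𝓘(ℂ, E) (fun y : G => p * y * p⁻¹) y : E →L[ℂ] E).inverse =
    (mfderiv 𝓘(ℂ, E) 𝓘(ℂ, E) (fun y : G => p⁻¹ * y * p⁻¹⁻¹) (p * y * p⁻¹) : E →L[ℂ] E) := by
  have hA : (fun y : G => p⁻¹ * y * p⁻¹⁻¹) ∘ (fun y : G => p * y * p⁻¹) = id := by
    ext y; simp [mul_assoc]
  have hB : (fun y : G => p * y * p⁻¹) ∘ (fun y : G => p⁻¹ * y * p⁻¹⁻¹) = id := by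
    ext y; simp [mul_assoc]
  have h1 : p⁻¹ * (p * y * p⁻¹) * p⁻¹⁻¹ = y := by simp [mul_assoc]
  have kA := mfderiv_comp (I := 𝓘(ℂ, E)) (I' := 𝓘(ℂ, E)) (I'' := 𝓘(ℂ, E)) y
    (mdiff_conj p⁻¹ (p * y * p⁻¹)) (mdiff_conj p y)
  have kB := mfderiv_comp (I := 𝓘(ℂ, E)) (I' := 𝓘(ℂ, E)) (I'' := 𝓘(ℂ, E)) (p * y * p⁻¹)
    (mdiff_conj p (p⁻¹ * (p * y * p⁻¹) * p⁻¹⁻¹)) (mdiff_conj p⁻¹ (p * y * p⁻¹))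
  rw [hA, mfderiv_id] at kA
  rw [hB, mfderiv_id, h1] at kB
  exact ContinuousLinearMap.inverse_eq kB.symm kA.symm

theorem mfderiv_conj_mulInvariantVectorField (p y : G) (x : LieAlg E G) :
    (mfderiv 𝓘(ℂ, E) 𝓘(ℂ, E) (fun y : G => p * y * p⁻¹) y : E →L[ℂ] E)
      (mulInvariantVectorField x y) = mulInvariantVectorField (Ad p x) (p * y * p⁻¹) := by
  have mL : ∀ a b : G, MDifferentiableAt 𝓘(ℂ, E) 𝓘(ℂ, E) (fun z : G => a * z) b := fun a b =>
    (contMDiff_mul_left (I := 𝓘(ℂ, E)) (n := ω) (a := a)).mdifferentiableAt (by simp)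
  have h : (fun z : G => p * z * p⁻¹) ∘ (fun z : G => y * z) =
      (fun z : G => p * y * p⁻¹ * z) ∘ (fun z : G => p * z * p⁻¹) := by
    ext z; simp [mul_assoc]
  have k1 := mfderiv_comp (I := 𝓘(ℂ, E)) (I' := 𝓘(ℂ, E)) (I'' := 𝓘(ℂ, E)) (1 : G)
    (mdiff_conj p (y * 1)) (mL y 1)
  have k2 := mfderiv_comp (I := 𝓘(ℂ, E)) (I' := 𝓘(ℂ, E)) (I'' := 𝓘(ℂ, E)) (1 : G)
    (mL (p * y * p⁻¹) (p * 1 * p⁻¹)) (mdiff_conj p 1)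
  rw [h, k2] at k1
  have e1 : y * 1 = y := mul_one y
  have e2 : p * 1 * p⁻¹ = 1 := by simp
  rw [e1, e2] at k1
  exact (congrArg (fun f : E →L[ℂ] E => f x) k1).symm

theorem mpullback_conj (p : G) (x : LieAlg E G) :
    VectorField.mpullback 𝓘(ℂ, E) 𝓘(ℂ, E) (fun y : G => p * y * p⁻¹)
      (mulInvariantVectorField (Ad p x)) = mulInvariantVectorField x := by
  ext y
  have h1 : p⁻¹ * (p * y * p⁻¹) * p⁻¹⁻¹ = y := by simp [mul_assoc]
  have h2 := mfderiv_conj_mulInvariantVectorField p⁻¹ (p * y * p⁻¹) (Ad p x)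
  rw [← Ad_mul, inv_mul_cancel, Ad_one, h1] at h2
  exact (congrArg (fun f : E →L[ℂ] E => f (mulInvariantVectorField (Ad p x) (p * y * p⁻¹)))
    (mfderiv_conj_inv p y)).trans h2

variable [CompleteSpace E]

theorem Ad_lie (p : G) (x y : LieAlg E G) : Ad p ⁅x, y⁆ = ⁅Ad p x, Ad p y⁆ := by
  have e2 : p * 1 * p⁻¹ = 1 := by simp
  have h := VectorField.mpullback_mlieBracket (I := 𝓘(ℂ, E)) (I' := 𝓘(ℂ, E)) (n := ω)
    (f := fun y : G => p * y * p⁻¹) (x₀ := 1)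
    (V := mulInvariantVectorField (Ad p x)) (W := mulInvariantVectorField (Ad p y))
    (mdifferentiableAt_mulInvariantVectorField _) (mdifferentiableAt_mulInvariantVectorField _)
    (((contMDiff_mul_right (I := 𝓘(ℂ, E)) (n := ω) (a := p⁻¹)).comp
      (contMDiff_mul_left (I := 𝓘(ℂ, E)) (n := ω) (a := p))).contMDiffAt) le_top
  rw [mpullback_conj, mpullback_conj, ← mulInvariantVector_mlieBracket] at h
  have h3 : Ad p (Ad p⁻¹ ⁅Ad p x, Ad p y⁆) = ⁅Ad p x, Ad p y⁆ := by
    rw [← Ad_mul, mul_inv_cancel, Ad_one]; rfl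
  have h4 : (mulInvariantVectorField ⁅Ad p x, Ad p y⁆ :
      (q : G) → TangentSpace 𝓘(ℂ, E) q) = mulInvariantVectorField (Ad p (Ad p⁻¹ ⁅Ad p x, Ad p y⁆)) := by
    rw [h3]
  change VectorField.mpullback 𝓘(ℂ, E) 𝓘(ℂ, E) (fun y : G => p * y * p⁻¹)
    (mulInvariantVectorField ⁅Ad p x, Ad p y⁆) 1 = ⁅x, y⁆ at h
  rw [h4, mpullback_conj] at h
  have h5 : ∀ w : LieAlg E G, mulInvariantVectorField w (1 : G) = w := by
    intro w
    have : (fun z : G => 1 * z) = id := by ext z; simp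
    have h6 : (mfderiv 𝓘(ℂ, E) 𝓘(ℂ, E) (fun z : G => 1 * z) 1 : E →L[ℂ] E)
        = ContinuousLinearMap.id ℂ E := by
      rw [this]; exact mfderiv_id
    exact congrArg (fun f : E →L[ℂ] E => f w) h6
  rw [← h3, ← h, h5]

end AdjointAction

section AssociatedBundles

variable {E : Type*} [NormedAddCommGroup E] [NormedSpace ℂ E]
  {G : Type*} [TopologicalSpace G] [ChartedSpace E G] [Group G]
  {V : Type*} [AddCommGroup V] [Module ℂ V]

/-- `C^∞` maps (in the real sense) from `G` to a finite-dimensional complex vector space,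
tested on linear functionals. -/
def IsSmooth (f : G → V) : Prop :=
  ∀ ℓ : Module.Dual ℂ V, ContMDiff 𝓘(ℝ, E) 𝓘(ℝ, ℂ) ∞ (fun p => ℓ (f p))

/-- `Ω^{0,0}(G/B, G ×_B V)`, for an action `ρ` of a subgroup `B` of `G` on `V`: a smooth section
of the associated bundle `G ×_B V` over `G/B` is a smooth map `s : G → V` with
`s (p b) = ρ(b)⁻¹ (s p)`. -/
structure SmoothSection (E : Type*) [NormedAddCommGroup E] [NormedSpace ℂ E] [ChartedSpace E G]
    {B : Subgroup G} (ρ : B → Module.End ℂ V) where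
  toFun : G → V
  smooth : IsSmooth (E := E) toFun
  equivariant : ∀ (p : G) (b : B), ρ b (toFun (p * b)) = toFun p

instance {B : Subgroup G} (ρ : B → Module.End ℂ V) :
    CoeFun (SmoothSection E ρ) (fun _ => G → V) :=
  ⟨SmoothSection.toFun⟩

/-- `Ω^{0,1}(G/B, G ×_B V)`, where `𝔟` is the Lie algebra of `B`. The tangent bundle of `G` is
trivialized by left-invariant vector fields, `(p, X) ↦ d/dt p exp(tX)`, and the tangent bundle of
`G/B` is `G ×_B (𝔤/𝔟)`. So a `(0,1)`-form on `G/B` with values in `G ×_B V` is a smooth map `ω`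
from `G` to the conjugate-linear maps `𝔤 → V` vanishing on `𝔟`, with
`ω (p b) (Ad(b)⁻¹ X) = ρ(b)⁻¹ (ω p X)`. -/
structure Form01 {B : Subgroup G} (𝔟 : Submodule ℂ (LieAlg E G)) (ρ : B → Module.End ℂ V) where
  toFun : G → LieAlg E G →ₗ⋆[ℂ] V
  smooth : ∀ X : LieAlg E G, IsSmooth (E := E) (fun p => toFun p X)
  horizontal : ∀ (p : G), ∀ X ∈ 𝔟, toFun p X = 0
  equivariant : ∀ (p : G) (b : B) (X : LieAlg E G),
    ρ b (toFun (p * b) X) = toFun p (Ad (b : G) X)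

instance {B : Subgroup G} (𝔟 : Submodule ℂ (LieAlg E G)) (ρ : B → Module.End ℂ V) :
    CoeFun (Form01 𝔟 ρ) (fun _ => G → LieAlg E G →ₗ⋆[ℂ] V) :=
  ⟨Form01.toFun⟩

/-- The (real) derivative of `f : G → ℂ` at `p` along the left-invariant vector field of `X`. -/
def leftDeriv (f : G → ℂ) (p : G) (X : LieAlg E G) : ℂ :=
  (mfderiv 𝓘(ℝ, E) 𝓘(ℝ, ℂ) (fun y : G => f (p * y)) 1 : E →L[ℝ] ℂ) X

/-- The Cauchy-Riemann operator on functions: the `(0,1)`-part of the differential,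
`∂̄f(X) = (df(X) + i df(iX)) / 2`. On `B`-equivariant functions it is the `∂̄`-operator of the
corresponding holomorphic line bundle over `G/B`. -/
def dbar (f : G → ℂ) (p : G) (X : LieAlg E G) : ℂ :=
  (1 / 2 : ℂ) * (leftDeriv f p X + Complex.I * leftDeriv f p (Complex.I • X))

end AssociatedBundles

section Borel

variable {E : Type*} [NormedAddCommGroup E] [NormedSpace ℂ E] [FiniteDimensional ℂ E]
  [CompleteSpace E]
  {G : Type*} [TopologicalSpace G] [ChartedSpace E G] [Group G] [LieGroup 𝓘(ℂ, E) ω G]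
  [LieAlgebra.IsSimple ℂ (LieAlg E G)]
  {H : LieSubalgebra ℂ (LieAlg E G)} [H.IsCartanSubalgebra]

/-- The set `Φ⁻` of negative roots. -/
def NegRoot (Δ : (LieAlgebra.IsKilling.rootSystem H).Base) : Type _ :=
  {α : H.root // Δ.height α < 0}

instance (Δ : (LieAlgebra.IsKilling.rootSystem H).Base) : Fintype (NegRoot Δ) :=
  haveI : Finite (NegRoot Δ) := inferInstanceAs (Finite {α : H.root // Δ.height α < 0})
  Fintype.ofFinite _

/-- The root space `𝔤_α` of a negative root `α`. -/
def NegRoot.space {Δ : (LieAlgebra.IsKilling.rootSystem H).Base} (α : NegRoot Δ) :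
    Submodule ℂ (LieAlg E G) :=
  (LieAlgebra.rootSpace H (α.1.1 : H → ℂ)).toSubmodule

/-- The Borel subalgebra `𝔟 = 𝔥 ⊕ ⨁_{α ∈ Φ⁻} 𝔤_α`. -/
def borelSubalgebra (Δ : (LieAlgebra.IsKilling.rootSystem H).Base) :
    Submodule ℂ (LieAlg E G) :=
  H.toSubmodule ⊔ ⨆ α : NegRoot Δ, α.space

/-- The Borel subgroup `B` of the connected group `G` with Lie algebra `𝔟`: the normalizer
of `𝔟` in `G`. -/
def borel (Δ : (LieAlgebra.IsKilling.rootSystem H).Base) : Subgroup G where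
  carrier := {p | ∀ X : LieAlg E G, Ad p X ∈ borelSubalgebra Δ ↔ X ∈ borelSubalgebra Δ}
  one_mem' := fun X => by rw [Ad_one]; rfl
  mul_mem' := fun {p q} hp hq X => by rw [Ad_mul, hp, hq]
  inv_mem' := fun {p} hp X => by
    rw [← hp, ← Ad_mul, mul_inv_cancel, Ad_one]; rfl

/-- The action of `B` on `𝔤`; its associated bundle is `G × 𝔤/B`. -/
def adAction (Δ : (LieAlgebra.IsKilling.rootSystem H).Base) :
    borel Δ → Module.End ℂ (LieAlg E G) :=
  fun b => Ad (b : G)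

/-- The Lie bracket of the bundle `G × 𝔤/B`, on smooth sections. -/
def SmoothSection.bracket {Δ : (LieAlgebra.IsKilling.rootSystem H).Base}
    (s t : SmoothSection E (adAction Δ)) : SmoothSection E (adAction Δ) where
  toFun p := ⁅s p, t p⁆
  smooth ℓ := by
    let e := Module.finBasis ℂ (LieAlg E G)
    have h : (fun p : G => ℓ ⁅s p, t p⁆) = fun p =>
        ∑ i, ∑ j, e.coord i (s p) * (e.coord j (t p) * ℓ ⁅e i, e j⁆) := by
      funext p
      have h1 : ⁅s p, t p⁆ = ⁅∑ i, e.repr (s p) i • e i, ∑ j, e.repr (t p) j • e j⁆ := by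
        rw [e.sum_repr, e.sum_repr]
      rw [h1, sum_lie_sum]
      simp only [map_sum, smul_lie, lie_smul, map_smul, smul_eq_mul, Module.Basis.coord_apply]
      exact Finset.sum_congr rfl fun i _ => Finset.sum_congr rfl fun j _ => by ring
    rw [h]
    have hm : ContDiff ℝ ∞ (fun z : ℂ × ℂ => z.1 * z.2) := contDiff_fst.mul contDiff_snd
    refine contMDiff_finsetSum fun i _ => contMDiff_finsetSum fun j _ => ?_
    exact hm.contMDiff.comp ((s.smooth (e.coord i)).prodMk_space
      (hm.contMDiff.comp ((t.smooth (e.coord j)).prodMk_space contMDiff_const)))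
  equivariant p b := by
    change Ad (b : G) ⁅s (p * b), t (p * b)⁆ = ⁅s p, t p⁆
    rw [Ad_lie]
    exact congrArg₂ _ (s.equivariant p b) (t.equivariant p b)

/-- A complete `B`-filtration `0 = F₀ ⊂ F₁ ⊂ ⋯ ⊂ F_N = 𝔤` of `𝔤`, given with an adapted basis
`e` of weight vectors: `F_k` is spanned by the first `k` basis vectors and is a `B`-submodule. -/
structure BFiltration (Δ : (LieAlgebra.IsKilling.rootSystem H).Base) where
  e : Module.Basis (Fin (Module.finrank ℂ (LieAlg E G))) ℂ (LieAlg E G)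
  weight : Fin (Module.finrank ℂ (LieAlg E G)) → H → ℂ
  e_mem : ∀ i, e i ∈ LieAlgebra.rootSpace H (weight i)
  stable : ∀ (k : ℕ) (b : borel Δ), ∀ x ∈ Submodule.span ℂ (e '' {i | i.val < k}),
    Ad (b : G) x ∈ Submodule.span ℂ (e '' {i | i.val < k})

namespace BFiltration

variable {Δ : (LieAlgebra.IsKilling.rootSystem H).Base} (F : BFiltration Δ)

/-- The step `F_k` of the filtration. -/
def step (k : ℕ) : Submodule ℂ (LieAlg E G) :=
  Submodule.span ℂ (F.e '' {i | i.val < k})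

/-- The character by which `B` acts on the line `F_{i+1}/F_i = ℂ e_i` (with `i` counted from
`0`). The line bundle `L_{λ_i}`, for `λ_i` the weight of `e_i`, is the line bundle over `G/B`
associated with it. -/
def char (i : Fin (Module.finrank ℂ (LieAlg E G))) (b : borel Δ) : ℂ :=
  F.e.coord i (Ad (b : G) (F.e i))

/-- The action of `B` on the graded space `⨁ F_{i+1}/F_i`, which is identified with `𝔤` by the
basis `e`. The associated bundle is `⨁_i L_{λ_i}`. -/
def gradedAction (b : borel Δ) : Module.End ℂ (LieAlg E G) :=
  F.e.constr ℂ (fun i => F.char i b • F.e i)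

/-- The action of `B` on `ℂ` whose associated line bundle is `L_{λ_i} ⊗ L_{λ_j}^*`. -/
def homAction (i j : Fin (Module.finrank ℂ (LieAlg E G))) (b : borel Δ) : Module.End ℂ ℂ :=
  (F.char i b * (F.char j b)⁻¹) • LinearMap.id

/-- `Ω^{0,1}(G/B, L_α)` for `α ∈ Φ⁻`, with `L_α ⊂ ⨁_i L_{λ_i}` the line subbundle with fibre
`𝔤_α`: the forms with values in `⨁_i L_{λ_i}` that take their values in `𝔤_α`. -/
structure RootForm (α : NegRoot Δ) extends Form01 (borelSubalgebra Δ) F.gradedAction where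
  mem_space : ∀ (p : G) (X : LieAlg E G), toFun p X ∈ α.space

/-- A smooth splitting of the filtration of `G × 𝔤/B` by the subbundles `G × F_k/B`, compatible
with the Lie bracket: a smooth isomorphism of Lie algebra bundles from `G × 𝔤/B` to
`⨁_i L_{λ_i}` (whose fibre is the Lie algebra `𝔤`) that maps each subbundle `G × F_k/B` to
`L_{λ_1} ⊕ ⋯ ⊕ L_{λ_k}` and induces the identity on the quotients `L_{λ_i}`. -/
structure SmoothSplitting where
  toFun : G → LieAlg E G ≃ₗ⁅ℂ⁆ LieAlg E G
  smooth : ∀ x : LieAlg E G, IsSmooth (E := E) (fun p => toFun p x)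
  equivariant : ∀ (p : G) (b : borel Δ) (x : LieAlg E G),
    F.gradedAction b (toFun (p * b) x) = toFun p (Ad (b : G) x)
  graded : ∀ (p : G) (i : Fin (Module.finrank ℂ (LieAlg E G))),
    toFun p (F.e i) - F.e i ∈ F.step i.val

instance : CoeFun F.SmoothSplitting (fun _ => G → LieAlg E G ≃ₗ⁅ℂ⁆ LieAlg E G) :=
  ⟨SmoothSplitting.toFun⟩

/-- The standard holomorphic structure `∂̄₀` of `⨁_i L_{λ_i}`: the operator `∂̄` on each
summand. -/
def dbarZero (t : G → LieAlg E G) (p : G) (X : LieAlg E G) : LieAlg E G :=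
  ∑ i, dbar (fun q => F.e.coord i (t q)) p X • F.e i

end BFiltration

/-- An operator `D : Ω^{0,0}(G/B, G × 𝔤/B) → Ω^{0,1}(G/B, G × 𝔤/B)` has, in the splitting `Θ`,
an upper-triangular matrix with diagonal entries `∂̄` and with entries
`φ_{ij} ∈ Ω^{0,1}(G/B, L_{λ_i} ⊗ L_{λ_j}^*)` for `i < j`. -/
def IsUpperTriangular {Δ : (LieAlgebra.IsKilling.rootSystem H).Base} {F : BFiltration Δ}
    (Θ : F.SmoothSplitting)
    (D : SmoothSection E (adAction Δ) → Form01 (borelSubalgebra Δ) (adAction Δ)) : Prop :=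
  ∃ φ : (i j : Fin (Module.finrank ℂ (LieAlg E G))) →
      Form01 (borelSubalgebra Δ) (F.homAction i j),
    ∀ (s : SmoothSection E (adAction Δ)) (p : G) (X : LieAlg E G),
      Θ p (D s p X) = F.dbarZero (fun q => Θ q (s q)) p X +
        ∑ i, ∑ j ∈ Finset.Ioi i, (φ i j p X * F.e.coord j (Θ p (s p))) • F.e i

/-- `D [ , ] = 0`: the operator `D` is a derivation of the Lie bracket of `G × 𝔤/B`. -/
def PreservesBracket {Δ : (LieAlgebra.IsKilling.rootSystem H).Base}
    (D : SmoothSection E (adAction Δ) → Form01 (borelSubalgebra Δ) (adAction Δ)) : Prop :=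
  ∀ (s t : SmoothSection E (adAction Δ)) (p : G) (X : LieAlg E G),
    D (s.bracket t) p X = ⁅D s p X, t p⁆ + ⁅s p, D t p X⁆

end Borel

end FlagBundle

end

noncomputable section

/-! ### Strictly triangular adjoint actions in a basis of weight vectors -/

section WeightBasis

open LieAlgebra LieAlgebra.IsKilling

variable {K L ι : Type*} [Field K] [CharZero K] [LieRing L] [LieAlgebra K L] [IsKilling K L]
  [FiniteDimensional K L] {H : LieSubalgebra K L} [H.IsCartanSubalgebra]
  [LieModule.IsTriangularizable K H L] [Fintype ι]
  {e : Module.Basis ι K L} {w : ι → H → K}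

/-! In the splitting, the operator is `∂̄₀ + A`, with `A` a strictly upper-triangular matrix of
order zero. The structure constants of `𝔤` in the basis `e` are constant, so `∂̄₀` is itself a
derivation (`BFiltration.dbarZero_lie`). Since sections take arbitrary values at a given point,
preserving the bracket means exactly that each value of `A` is a derivation of `𝔤`
(`preservesBracket_iff`). This settles the direction from root forms to derivations, because `ad`
consists of derivations.

Conversely, derivations of `𝔤` are inner, so each value of `A` is `ad a` for a unique `a`, and
strict triangularity must force `a` into the sum of the negative root spaces. The diagonal of `ad a`
consists of the weights evaluated on the Cartan part of `a`; they all vanish, so that part is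
central, hence zero. If `a` had a component along a positive root `α`, spanned by `e i`, then `ad (e
i)` would be strictly triangular. Complete `e i`, up to scale, to an `sl₂`-triple with `y` in
`𝔤_{-α}`. As `y` preserves the filtration, the coroot `h`, a multiple of `⁅y, e i⁆`, lies in the
span of the `e m` with `m ≤ i`, and strictness then kills coordinate `i` of `⁅e i, h⁆ = -2 e i`, a
contradiction (`weight_ne_of_coord_ne_zero`).

The filtration is assumed stable only under the group `B`, the normalizer of `𝔟`. Its stability
under negative root vectors is obtained by differentiating along curves in `B` on which `Ad` is `exp
(t ad y)`. This needs the derivative of `Ad` at the unit to be the bracket of left-invariant fields,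
which is computed from second derivatives of the group law in a chart.

Finally, `a` is recovered from `A` by one fixed linear left inverse of `ad`, so its weight
components inherit smoothness and conjugate-linearity from the entries of `A`. Equivariance follows
since the graded action is by diagonal Lie automorphisms and the centre is zero. -/

theorem coord_eq_zero_of_mem_rootSpace (he : ∀ i, e i ∈ rootSpace H (w i)) {χ : H → K} {x : L}
    (hx : x ∈ rootSpace H χ) {i : ι} (hi : w i ≠ χ) : e.coord i x = 0 := by
  obtain ⟨h, hh⟩ := Function.ne_iff.mp hi
  have h1 : ⁅(h : L), x⁆ = χ h • x := lie_eq_smul_of_mem_rootSpace hx h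
  have h2 : ⁅(h : L), x⁆ = ∑ j, (e.repr x j * w j h) • e j := by
    conv_lhs => rw [← e.sum_repr x, lie_sum]
    refine Finset.sum_congr rfl fun j _ => ?_
    rw [lie_smul, mul_smul]
    exact congrArg _ (lie_eq_smul_of_mem_rootSpace (he j) h)
  have h3 : e.coord i ⁅(h : L), x⁆ = e.coord i x * w i h := by
    classical
    rw [h2]
    simp only [map_sum, map_smul, Module.Basis.coord_apply, Module.Basis.repr_self]
    simp [Finsupp.single_apply]
  rw [h1, map_smul, smul_eq_mul] at h3
  have h4 : (w i h - χ h) * e.coord i x = 0 := by linear_combination -h3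
  exact (mul_eq_zero.mp h4).resolve_left (sub_ne_zero.mpr hh)

theorem coord_lie_eq_zero (he : ∀ i, e i ∈ rootSpace H (w i)) {i j k : ι}
    (hk : w k ≠ w i + w j) : e.coord k ⁅e i, e j⁆ = 0 :=
  coord_eq_zero_of_mem_rootSpace he
    (lie_mem_genWeightSpace_of_mem_genWeightSpace (he i) (he j)) hk

theorem coord_lie_eq_sum (a x : L) (k : ι) :
    e.coord k ⁅a, x⁆ = ∑ i, e.coord i a * e.coord k ⁅e i, x⁆ := by
  conv_lhs => rw [← e.sum_repr a, sum_lie, map_sum]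
  simp only [smul_lie, map_smul, smul_eq_mul, Module.Basis.coord_apply]

variable [LinearOrder ι]

/-- An element whose adjoint action is strictly triangular in a basis of weight vectors has no
Cartan component. -/
theorem weight_ne_zero_of_coord_ne_zero (he : ∀ i, e i ∈ rootSpace H (w i)) {a : L}
    (ha : ∀ j k, j ≤ k → e.coord k ⁅a, e j⁆ = 0) {i : ι} (hi : e.coord i a ≠ 0) : w i ≠ 0 := by
  classical
  intro hw
  -- The vector in question is the Cartan component of `a`; it will be shown to be central.
  have hz : (∑ m, if w m = 0 then e.coord m a • e m else 0) ∈ rootSpace H (0 : H → K) := by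
    refine Submodule.sum_mem (rootSpace H (0 : H → K)).toSubmodule fun m _ => ?_
    split_ifs with hm
    · exact Submodule.smul_mem _ _ (hm ▸ he m)
    · exact Submodule.zero_mem _
  set z := ∑ m, if w m = 0 then e.coord m a • e m else 0 with hzdef
  have hzH : z ∈ H := by
    rw [rootSpace_zero_eq] at hz
    exact hz
  have hcoord : ∀ m, e.coord m z = if w m = 0 then e.coord m a else 0 := by
    intro m
    have : z = ∑ m, (if w m = 0 then e.coord m a else 0) • e m := by
      simp only [hzdef, ite_smul, zero_smul]
    rw [this]
    simp only [map_sum, map_smul, Module.Basis.coord_apply, Module.Basis.repr_self]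
    simp [Finsupp.single_apply]
  have hzero : ∀ j, ⁅z, e j⁆ = 0 := by
    intro j
    have h1 : ⁅z, e j⁆ = w j ⟨z, hzH⟩ • e j := lie_eq_smul_of_mem_rootSpace (he j) ⟨z, hzH⟩
    -- A diagonal entry of `ad a` only sees the weight-zero part of `a`.
    have h2 : e.coord j ⁅z, e j⁆ = e.coord j ⁅a, e j⁆ := by
      rw [coord_lie_eq_sum z, coord_lie_eq_sum a]
      refine Finset.sum_congr rfl fun m _ => ?_
      rw [hcoord]
      split_ifs with hm
      · rfl
      · rw [coord_lie_eq_zero he fun h => hm (by simpa using h), mul_zero, mul_zero]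
    rw [ha j j le_rfl, h1] at h2
    have h3 : w j ⟨z, hzH⟩ = 0 := by simpa using h2
    rw [h1, h3, zero_smul]
  have hcenter : z = 0 := by
    have h1 : z ∈ LieAlgebra.center K L := by
      rw [LieModule.mem_maxTrivSubmodule]
      intro x
      rw [← e.sum_repr x, sum_lie]
      refine Finset.sum_eq_zero fun j _ => ?_
      rw [smul_lie, ← lie_skew, hzero, neg_zero, smul_zero]
    simpa using h1
  apply hi
  have := hcoord i
  rw [hcenter, map_zero, if_pos hw] at this
  exact this.symm

/-- An element whose adjoint action is strictly triangular in a basis of weight vectors has no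
component in a root space `𝔤_α` such that `𝔤_{-α}` acts by triangular matrices. -/
theorem weight_ne_of_coord_ne_zero (he : ∀ i, e i ∈ rootSpace H (w i)) {a : L}
    (ha : ∀ j k, j ≤ k → e.coord k ⁅a, e j⁆ = 0) {α : LieModule.Weight K H L}
    (hα : α.IsNonZero)
    (hneg : ∀ y ∈ rootSpace H (-α : H → K), ∀ j k, j < k → e.coord k ⁅y, e j⁆ = 0)
    {i : ι} (hi : e.coord i a ≠ 0) : w i ≠ α := by
  classical
  intro hw
  -- Root spaces are lines, so `e i` is the only basis vector of weight `α`.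
  have hone : ∀ m, w m = α → m = i := by
    intro m hm
    by_contra hmi
    obtain ⟨c, hc⟩ := (finrank_eq_one_iff_of_nonzero'
      (⟨e i, hw ▸ he i⟩ : rootSpace H (α : H → K))
      (fun h => e.ne_zero i (congrArg Subtype.val h))).mp (finrank_rootSpace_eq_one α hα)
      ⟨e m, hm ▸ he m⟩
    have h1 : c • e i = e m := congrArg Subtype.val hc
    have h2 := congrArg (e.coord m) h1
    simp [Ne.symm hmi] at h2
  -- Strict triangularity passes from `a` to its `α`-component: an entry with `w k = w i + w j`
  -- receives a contribution from `e i` alone.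
  have hstrict : ∀ j k, j ≤ k → e.coord k ⁅e i, e j⁆ = 0 := by
    intro j k hjk
    by_cases hk : w k = w i + w j
    · have h1 := ha j k hjk
      rw [coord_lie_eq_sum, Finset.sum_eq_single i] at h1
      · exact (mul_eq_zero.mp h1).resolve_left hi
      · intro m _ hm
        rw [coord_lie_eq_zero he, mul_zero]
        intro h
        apply hm
        apply hone
        rw [hk] at h
        rw [← hw]
        exact (add_right_cancel h).symm
      · simp
    · exact coord_lie_eq_zero he hk
  obtain ⟨h, x, y, t, hx, hy⟩ := exists_isSl2Triple_of_weight_isNonZero hα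
  have hcor := t.h_eq_coroot hα hx hy
  obtain ⟨c, hc⟩ := (finrank_eq_one_iff_of_nonzero'
      (⟨e i, hw ▸ he i⟩ : rootSpace H (α : H → K))
      (fun h => e.ne_zero i (congrArg Subtype.val h))).mp (finrank_rootSpace_eq_one α hα)
      ⟨x, hx⟩
  have hxc : x = c • e i := (congrArg Subtype.val hc).symm
  have hc0 : c ≠ 0 := by
    rintro rfl
    exact t.e_ne_zero (by simpa using hxc)
  have hh2 : ⁅e i, h⁆ = (-2 : K) • e i := by
    have h1 : ⁅(coroot α : L), e i⁆ = α (coroot α) • e i :=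
      lie_eq_smul_of_mem_rootSpace (hw ▸ he i) _
    rw [root_apply_coroot hα, ← hcor] at h1
    rw [← lie_skew, h1, neg_smul]
  -- Coordinate `i` of `⁅e i, h⁆ = -2 e i`. Some `e m` occurring in `h` must contribute, and
  -- strictness gives `i < m`; triangularity of `y` excludes this.
  have hsum : ∑ m, e.coord m h * e.coord i ⁅e i, e m⁆ = -2 := by
    have h1 : e.coord i ⁅e i, h⁆ = ∑ m, e.coord m h * e.coord i ⁅e i, e m⁆ := by
      conv_lhs => rw [← e.sum_repr h, lie_sum, map_sum]
      simp only [lie_smul, map_smul, smul_eq_mul, Module.Basis.coord_apply]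
    rw [← h1, hh2]
    simp
  obtain ⟨m, -, hm⟩ := Finset.exists_ne_zero_of_sum_ne_zero
    (hsum.trans_ne (neg_ne_zero.mpr two_ne_zero))
  have him : i < m := by
    by_contra hle
    exact hm (by rw [hstrict m i (not_lt.mp hle), mul_zero])
  apply hm
  have h1 : e.coord m h = 0 := by
    have h2 := hneg y hy i m him
    rw [← t.lie_e_f, hxc, ← lie_skew, lie_smul, map_neg, map_smul, h2, smul_zero, neg_zero]
  rw [h1, zero_mul]

end WeightBasis

namespace FlagBundle

/-! ### The group law and the adjoint representation in a chart at the unit -/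

section LocalGroupLaw

open Topology Filter

variable {E : Type*} [NormedAddCommGroup E] [NormedSpace ℂ E]
  {G : Type*} [TopologicalSpace G] [ChartedSpace E G] [Group G]

variable (E G) in
/-- The coordinates of the unit of `G`. -/
def unitChart : E := extChartAt 𝓘(ℂ, E) (1 : G) 1

variable (E G) in
/-- The inverse of the chart of `G` at the unit. -/
def ofChart (x : E) : G := (extChartAt 𝓘(ℂ, E) (1 : G)).symm x

variable (E G) in
/-- The group law in the chart at the unit. -/
def mulChart (z : E × E) : E := extChartAt 𝓘(ℂ, E) (1 : G) (ofChart E G z.1 * ofChart E G z.2)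

variable (E G) in
/-- Conjugation `(x, y) ↦ x y x⁻¹` in the chart at the unit. -/
def conjChart (z : E × E) : E :=
  extChartAt 𝓘(ℂ, E) (1 : G) (ofChart E G z.1 * ofChart E G z.2 * (ofChart E G z.1)⁻¹)

variable (E G) in
/-- The adjoint representation in the chart at the unit. -/
def adChart (x : E) : E →L[ℂ] E :=
  mfderiv 𝓘(ℂ, E) 𝓘(ℂ, E) (fun y : G => ofChart E G x * y * (ofChart E G x)⁻¹) 1

variable (E G) in
/-- The derivative at `x` of the chart of `G` at the unit. -/
def chartDeriv (x : G) : E →L[ℂ] E :=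
  mfderiv 𝓘(ℂ, E) 𝓘(ℂ, E) (extChartAt 𝓘(ℂ, E) (1 : G)) x

/-- The derivative at the unit of a map `f : G → G`, on the model space. -/
def derivOne (f : G → G) : E →L[ℂ] E := mfderiv 𝓘(ℂ, E) 𝓘(ℂ, E) f 1

variable (G) in
theorem Ad_ofChart (x : E) (v : LieAlg E G) : Ad (ofChart E G x) v = adChart E G x v := rfl

@[simp] theorem ofChart_unitChart : ofChart E G (unitChart E G) = 1 :=
  (extChartAt 𝓘(ℂ, E) (1 : G)).left_inv (mem_extChartAt_source _)

variable (E G) in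
theorem unitChart_mem_target : unitChart E G ∈ (extChartAt 𝓘(ℂ, E) (1 : G)).target :=
  mem_extChartAt_target _

variable (E G) in
theorem eventually_mem_target :
    ∀ᶠ x in 𝓝 (unitChart E G), x ∈ (extChartAt 𝓘(ℂ, E) (1 : G)).target :=
  extChartAt_target_mem_nhds (I := 𝓘(ℂ, E)) (1 : G)

variable (E G) in
theorem eventually_mulChart_right :
    ∀ᶠ x in 𝓝 (unitChart E G), mulChart E G (x, unitChart E G) = x := by
  filter_upwards [eventually_mem_target E G] with x hx
  simp only [mulChart, ofChart_unitChart, mul_one]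
  exact (extChartAt 𝓘(ℂ, E) (1 : G)).right_inv hx

variable (E G) in
theorem eventually_mulChart_left :
    ∀ᶠ x in 𝓝 (unitChart E G), mulChart E G (unitChart E G, x) = x := by
  filter_upwards [eventually_mem_target E G] with x hx
  simp only [mulChart, ofChart_unitChart, one_mul]
  exact (extChartAt 𝓘(ℂ, E) (1 : G)).right_inv hx

@[simp] theorem mulChart_unitChart :
    mulChart E G (unitChart E G, unitChart E G) = unitChart E G := by
  simp only [mulChart, ofChart_unitChart, mul_one]
  rfl

@[simp] theorem conjChart_unitChart (x : E) :
    conjChart E G (x, unitChart E G) = unitChart E G := by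
  simp only [conjChart, ofChart_unitChart, mul_one, mul_inv_cancel]
  rfl

theorem tendsto_prodMk_unitChart :
    Tendsto (fun x : E => (x, unitChart E G)) (𝓝 (unitChart E G))
      (𝓝 (unitChart E G, unitChart E G)) :=
  (continuous_id.prodMk continuous_const).tendsto _

theorem hasMFDerivAt_of_eq {M N : Type*} [TopologicalSpace M] [ChartedSpace E M]
    [TopologicalSpace N] [ChartedSpace E N] {f : M → N} {x y : M} {A : E →L[ℂ] E}
    (h : HasMFDerivAt 𝓘(ℂ, E) 𝓘(ℂ, E) f x A) (hxy : x = y) :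
    HasMFDerivAt 𝓘(ℂ, E) 𝓘(ℂ, E) f y A := by
  subst hxy
  exact h

variable [LieGroup 𝓘(ℂ, E) ω G]

variable (E G) in
theorem contMDiffAt_ofChart {x : E} (hx : x ∈ (extChartAt 𝓘(ℂ, E) (1 : G)).target) :
    ContMDiffAt 𝓘(ℂ, E) 𝓘(ℂ, E) ω (ofChart E G) x :=
  (contMDiffOn_extChartAt_symm (I := 𝓘(ℂ, E)) (n := ω) (1 : G)).contMDiffAt
    ((isOpen_extChartAt_target (I := 𝓘(ℂ, E)) (1 : G)).mem_nhds hx)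

variable (E G) in
theorem contDiffAt_mulChart :
    ContDiffAt ℂ ω (mulChart E G) (unitChart E G, unitChart E G) := by
  rw [← contMDiffAt_iff_contDiffAt]
  have h1 : ContMDiffAt 𝓘(ℂ, E × E) 𝓘(ℂ, E) ω (fun z : E × E => ofChart E G z.1)
      (unitChart E G, unitChart E G) :=
    ContMDiffAt.comp _ (contMDiffAt_ofChart E G (unitChart_mem_target E G))
      contDiff_fst.contMDiff.contMDiffAt
  have h2 : ContMDiffAt 𝓘(ℂ, E × E) 𝓘(ℂ, E) ω (fun z : E × E => ofChart E G z.2)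
      (unitChart E G, unitChart E G) :=
    ContMDiffAt.comp _ (contMDiffAt_ofChart E G (unitChart_mem_target E G))
      contDiff_snd.contMDiff.contMDiffAt
  refine ContMDiffAt.comp _ ?_ (h1.mul h2)
  apply contMDiffAt_extChartAt'
  simp

variable (E G) in
theorem contDiffAt_conjChart :
    ContDiffAt ℂ ω (conjChart E G) (unitChart E G, unitChart E G) := by
  rw [← contMDiffAt_iff_contDiffAt]
  have h1 : ContMDiffAt 𝓘(ℂ, E × E) 𝓘(ℂ, E) ω (fun z : E × E => ofChart E G z.1)
      (unitChart E G, unitChart E G) :=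
    ContMDiffAt.comp _ (contMDiffAt_ofChart E G (unitChart_mem_target E G))
      contDiff_fst.contMDiff.contMDiffAt
  have h2 : ContMDiffAt 𝓘(ℂ, E × E) 𝓘(ℂ, E) ω (fun z : E × E => ofChart E G z.2)
      (unitChart E G, unitChart E G) :=
    ContMDiffAt.comp _ (contMDiffAt_ofChart E G (unitChart_mem_target E G))
      contDiff_snd.contMDiff.contMDiffAt
  refine ContMDiffAt.comp _ ?_ ((h1.mul h2).mul h1.inv)
  apply contMDiffAt_extChartAt'
  simp

variable (E G) in
theorem eventually_differentiableAt_mulChart :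
    ∀ᶠ z in 𝓝 (unitChart E G, unitChart E G), DifferentiableAt ℂ (mulChart E G) z :=
  ((contDiffAt_mulChart E G).eventually (by simp)).mono fun _ h => h.differentiableAt (by simp)

variable (E G) in
theorem eventually_differentiableAt_conjChart :
    ∀ᶠ z in 𝓝 (unitChart E G, unitChart E G), DifferentiableAt ℂ (conjChart E G) z :=
  ((contDiffAt_conjChart E G).eventually (by simp)).mono fun _ h => h.differentiableAt (by simp)

/-- Derivative of a map of `G` in the chart at the unit, read off from `mfderiv`. -/
theorem fderiv_extChartAt_comp_ofChart {f : G → G}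
    (hf : MDifferentiableAt 𝓘(ℂ, E) 𝓘(ℂ, E) f 1)
    (h1 : f 1 ∈ (chartAt E (1 : G)).source) :
    fderiv ℂ (fun y => extChartAt 𝓘(ℂ, E) (1 : G) (f (ofChart E G y))) (unitChart E G) =
      (chartDeriv E G (f 1)).comp (derivOne f) := by
  -- The tangent space at `1` is identified with `E` by this very chart, so the inverse chart has
  -- identity derivative.
  have hs : HasMFDerivAt 𝓘(ℂ, E) 𝓘(ℂ, E) (ofChart E G) (unitChart E G)
      (ContinuousLinearMap.id ℂ E) := by
    have h2 := ((contMDiffAt_ofChart E G (unitChart_mem_target E G)).mdifferentiableAt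
      (by simp)).hasMFDerivAt
    have h3 := mfderivWithin_range_extChartAt_symm (I := 𝓘(ℂ, E)) (x := (1 : G))
    rw [modelWithCornersSelf_coe, Set.range_id, mfderivWithin_univ] at h3
    have h4 : mfderiv 𝓘(ℂ, E) 𝓘(ℂ, E) (ofChart E G) (unitChart E G) =
      ContinuousLinearMap.id ℂ E := h3
    rw [h4] at h2
    exact h2
  have hφ : HasMFDerivAt 𝓘(ℂ, E) 𝓘(ℂ, E) (extChartAt 𝓘(ℂ, E) (1 : G)) (f 1)
      (chartDeriv E G (f 1)) :=
    (mdifferentiableAt_extChartAt (I := 𝓘(ℂ, E)) h1).hasMFDerivAt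
  have h5 := (hasMFDerivAt_of_eq (A := derivOne f) hf.hasMFDerivAt ofChart_unitChart.symm).comp
    (unitChart E G) hs
  have h6 := (hasMFDerivAt_of_eq hφ (congrArg f ofChart_unitChart.symm)).comp (unitChart E G) h5
  have h7 : HasFDerivAt (fun y => extChartAt 𝓘(ℂ, E) (1 : G) (f (ofChart E G y)))
      ((chartDeriv E G (f 1)).comp (derivOne f)) (unitChart E G) :=
    hasMFDerivAt_iff_hasFDerivAt.mp h6
  exact h7.fderiv

variable (E G) in
theorem chartDeriv_one : chartDeriv E G 1 = ContinuousLinearMap.id ℂ E := mfderiv_extChartAt_self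

theorem fderiv_conjChart {x : E} :
    fderiv ℂ (fun y => conjChart E G (x, y)) (unitChart E G) = adChart E G x := by
  have h1 : ofChart E G x * 1 * (ofChart E G x)⁻¹ = 1 := by simp
  have h := fderiv_extChartAt_comp_ofChart (f := fun y => ofChart E G x * y * (ofChart E G x)⁻¹)
    (mdiff_conj _ _) (by rw [h1]; exact mem_chart_source E (1 : G))
  refine Eq.trans h ?_
  rw [h1]
  rw [chartDeriv_one]
  exact ContinuousLinearMap.ext fun _ => rfl

/-- The bracket of vector fields is computed after pulling back to the chart; there a left-invariant
field is a partial derivative of the group law in its second variable. -/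
theorem mpullbackWithin_mulInvariantVectorField (x : E)
    (hx : x ∈ (extChartAt 𝓘(ℂ, E) (1 : G)).target) (v : LieAlg E G) :
    VectorField.mpullbackWithin 𝓘(ℂ, E) 𝓘(ℂ, E) (extChartAt 𝓘(ℂ, E) (1 : G)).symm
      (mulInvariantVectorField v) (Set.range 𝓘(ℂ, E)) x =
    fderiv ℂ (fun y => mulChart E G (x, y)) (unitChart E G) v := by
  have hs : ofChart E G x * 1 ∈ (chartAt E (1 : G)).source := by
    rw [mul_one, ← extChartAt_source 𝓘(ℂ, E)]
    exact (extChartAt 𝓘(ℂ, E) (1 : G)).map_target hx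
  have h := fderiv_extChartAt_comp_ofChart (f := fun y => ofChart E G x * y)
    ((contMDiff_mul_left (I := 𝓘(ℂ, E)) (n := ω) (a := ofChart E G x)).mdifferentiableAt (by simp))
    hs
  have hinv := ContinuousLinearMap.inverse_eq
    (mfderivWithin_extChartAt_symm_comp_mfderiv_extChartAt (I := 𝓘(ℂ, E)) hx)
    (mfderiv_extChartAt_comp_mfderivWithin_extChartAt_symm (I := 𝓘(ℂ, E)) hx)
  rw [mul_one] at h
  exact (congrArg (fun f : E →L[ℂ] E =>
    f (mulInvariantVectorField v (ofChart E G x))) hinv).trans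
    (congrArg (fun f : E →L[ℂ] E => f v) h).symm

variable [CompleteSpace E]

variable (E G) in
theorem eventually_fderiv_mulChart_snd :
    ∀ᶠ x in 𝓝 (unitChart E G), ∀ v : E,
      fderiv ℂ (fun y => mulChart E G (x, y)) (unitChart E G) v =
        fderiv ℂ (mulChart E G) (x, unitChart E G) (0, v) := by
  filter_upwards [tendsto_prodMk_unitChart.eventually
    (eventually_differentiableAt_mulChart E G)] with x hx v
  have h1 : HasFDerivAt (fun y : E => (x, y)) (ContinuousLinearMap.inr ℂ E E) (unitChart E G) :=
    hasFDerivAt_prodMk_right x _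
  exact congrArg (fun f : E →L[ℂ] E => f v) (hx.hasFDerivAt.comp _ h1).fderiv

variable (E G) in
theorem eventually_adChart_eq :
    ∀ᶠ x in 𝓝 (unitChart E G), adChart E G x =
        (fderiv ℂ (conjChart E G) (x, unitChart E G)).comp (ContinuousLinearMap.inr ℂ E E) := by
  filter_upwards [tendsto_prodMk_unitChart.eventually
    (eventually_differentiableAt_conjChart E G)] with x hx
  have h1 : HasFDerivAt (fun y : E => (x, y)) (ContinuousLinearMap.inr ℂ E E) (unitChart E G) :=
    hasFDerivAt_prodMk_right x _
  rw [← fderiv_conjChart]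
  exact (hx.hasFDerivAt.comp _ h1).fderiv

variable (E G) in
theorem contDiffAt_adChart : ContDiffAt ℂ ω (adChart E G) (unitChart E G) := by
  have h1 : ContDiffAt ℂ ω (fderiv ℂ (conjChart E G)) (unitChart E G, unitChart E G) :=
    (contDiffAt_conjChart E G).fderiv_right (by simp)
  have h2 : ContDiffAt ℂ ω (fun x : E => fderiv ℂ (conjChart E G) (x, unitChart E G))
      (unitChart E G) :=
    ContDiffAt.comp (f := fun x : E => (x, unitChart E G)) (unitChart E G) h1
      (contDiffAt_id.prodMk contDiffAt_const)
  exact (h2.clm_comp contDiffAt_const).congr_of_eventuallyEq (eventually_adChart_eq E G)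

variable (E G) in
theorem differentiableAt_fderiv_mulChart :
    DifferentiableAt ℂ (fderiv ℂ (mulChart E G)) (unitChart E G, unitChart E G) :=
  ((contDiffAt_mulChart E G).fderiv_right (m := 1) (by simp)).differentiableAt (by simp)

theorem hasFDerivAt_fderiv_mulChart_left (v : E × E) :
    HasFDerivAt (fun x : E => fderiv ℂ (mulChart E G) (x, unitChart E G) v)
      (((fderiv ℂ (fderiv ℂ (mulChart E G)) (unitChart E G, unitChart E G)).comp
        (ContinuousLinearMap.inl ℂ E E)).flip v) (unitChart E G) := by
  have h1 : HasFDerivAt (fun x : E => (x, unitChart E G)) (ContinuousLinearMap.inl ℂ E E)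
    (unitChart E G) := hasFDerivAt_prodMk_left _ _
  have h2 := HasFDerivAt.comp (f := fun x : E => (x, unitChart E G)) (unitChart E G)
    (differentiableAt_fderiv_mulChart E G).hasFDerivAt h1
  refine (h2.clm_apply (hasFDerivAt_const v _)).congr_fderiv ?_
  ext z
  simp

/-- Restricted to either factor through the unit, multiplication is the identity. -/
theorem fderiv_mulChart_unitChart (v w : E) :
    fderiv ℂ (mulChart E G) (unitChart E G, unitChart E G) (v, w) = v + w := by
  have hd := (eventually_differentiableAt_mulChart E G).self_of_nhds.hasFDerivAt
  have h1 := (HasFDerivAt.comp (f := fun x : E => (x, unitChart E G)) (unitChart E G)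
    hd (hasFDerivAt_prodMk_left _ _)).unique
      ((hasFDerivAt_id (𝕜 := ℂ) (unitChart E G)).congr_of_eventuallyEq
        (eventually_mulChart_right E G))
  have h2 := (HasFDerivAt.comp (f := fun x : E => (unitChart E G, x)) (unitChart E G)
    hd (hasFDerivAt_prodMk_right _ _)).unique
      ((hasFDerivAt_id (𝕜 := ℂ) (unitChart E G)).congr_of_eventuallyEq
        (eventually_mulChart_left E G))
  have e : ((v, w) : E × E) = (v, 0) + (0, w) := by simp
  rw [e, map_add]
  congr 1
  · exact congrArg (fun f : E →L[ℂ] E => f v) h1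
  · exact congrArg (fun f : E →L[ℂ] E => f w) h2

theorem lieBracket_fderiv_mulChart (v w : E) :
    VectorField.lieBracket ℂ
      (fun x : E => fderiv ℂ (mulChart E G) (x, unitChart E G) (0, v))
      (fun x : E => fderiv ℂ (mulChart E G) (x, unitChart E G) (0, w)) (unitChart E G) =
      (fderiv ℂ (fderiv ℂ (mulChart E G)) (unitChart E G, unitChart E G) (v, 0) (0, w) -
        fderiv ℂ (fderiv ℂ (mulChart E G)) (unitChart E G, unitChart E G) (w, 0) (0, v) : E) := by
  have h2 := (hasFDerivAt_fderiv_mulChart_left (G := G) ((0, v) : E × E)).fderiv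
  have h3 := (hasFDerivAt_fderiv_mulChart_left (G := G) ((0, w) : E × E)).fderiv
  rw [VectorField.lieBracket, h2, h3, fderiv_mulChart_unitChart, fderiv_mulChart_unitChart,
    zero_add, zero_add]
  rfl

/-- The Lie bracket of `𝔤` in terms of the second derivative of the group law. -/
theorem bracket_eq_fderiv_mulChart (v w : LieAlg E G) :
    (⁅v, w⁆ : LieAlg E G) =
      (fderiv ℂ (fderiv ℂ (mulChart E G)) (unitChart E G, unitChart E G) (v, 0) (0, w) -
        fderiv ℂ (fderiv ℂ (mulChart E G)) (unitChart E G, unitChart E G) (w, 0) (0, v) : E) := by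
  let V : LieAlg E G → E → E := fun u => VectorField.mpullbackWithin 𝓘(ℂ, E) 𝓘(ℂ, E)
    (extChartAt 𝓘(ℂ, E) (1 : G)).symm (mulInvariantVectorField u) (Set.range 𝓘(ℂ, E))
  have hev : ∀ u : LieAlg E G, V u =ᶠ[𝓝 (unitChart E G)]
      fun x => fderiv ℂ (mulChart E G) (x, unitChart E G) (0, u) := by
    intro u
    filter_upwards [eventually_fderiv_mulChart_snd E G, eventually_mem_target E G] with x hx hx'
    exact (mpullbackWithin_mulInvariantVectorField x hx' u).trans (hx u)
  have hset : (extChartAt 𝓘(ℂ, E) (1 : G)).symm ⁻¹' Set.univ ∩ Set.range 𝓘(ℂ, E) = Set.univ := by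
    simp
  have hb : VectorField.lieBracketWithin ℂ (V v) (V w)
      ((extChartAt 𝓘(ℂ, E) (1 : G)).symm ⁻¹' Set.univ ∩ Set.range 𝓘(ℂ, E)) (unitChart E G) =
      VectorField.lieBracket ℂ (V v) (V w) (unitChart E G) := by
    rw [hset, VectorField.lieBracketWithin_univ]
  have hinv : (chartDeriv E G 1).inverse =
      ContinuousLinearMap.id ℂ E := by
    rw [chartDeriv_one]
    exact ContinuousLinearMap.inverse_id
  have h0 : (⁅v, w⁆ : LieAlg E G) =
      (chartDeriv E G 1).inverse
        (VectorField.lieBracketWithin ℂ (V v) (V w)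
      ((extChartAt 𝓘(ℂ, E) (1 : G)).symm ⁻¹' Set.univ ∩ Set.range 𝓘(ℂ, E)) (unitChart E G)) :=
    VectorField.mlieBracketWithin_apply (I := 𝓘(ℂ, E))
      (V := (mulInvariantVectorField v : (q : G) → TangentSpace 𝓘(ℂ, E) q))
      (W := (mulInvariantVectorField w : (q : G) → TangentSpace 𝓘(ℂ, E) q))
      (s := Set.univ) (x₀ := (1 : G))
  refine h0.trans ?_
  rw [hinv, hb]
  have h1 := Filter.EventuallyEq.lieBracket_vectorField_eq (𝕜 := ℂ) (hev v) (hev w)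
  exact h1.trans (lieBracket_fderiv_mulChart (E := E) (G := G) v w)

variable (E G) in
-- The identity `(x y x⁻¹) x = x y` characterizes conjugation through multiplication alone, so that
-- inversion need not be differentiated.
theorem eventually_mulChart_conjChart :
    ∀ᶠ z in 𝓝 (unitChart E G, unitChart E G),
      mulChart E G (conjChart E G z, z.1) = mulChart E G z := by
  have h1 : ContMDiffAt 𝓘(ℂ, E × E) 𝓘(ℂ, E) ω (fun z : E × E => ofChart E G z.1)
      (unitChart E G, unitChart E G) :=
    ContMDiffAt.comp _ (contMDiffAt_ofChart E G (unitChart_mem_target E G))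
      contDiff_fst.contMDiff.contMDiffAt
  have h2 : ContMDiffAt 𝓘(ℂ, E × E) 𝓘(ℂ, E) ω (fun z : E × E => ofChart E G z.2)
      (unitChart E G, unitChart E G) :=
    ContMDiffAt.comp _ (contMDiffAt_ofChart E G (unitChart_mem_target E G))
      contDiff_snd.contMDiff.contMDiffAt
  have h3 := ((h1.mul h2).mul h1.inv).continuousAt.eventually_mem
    (s := (extChartAt 𝓘(ℂ, E) (1 : G)).source)
    ((isOpen_extChartAt_source (I := 𝓘(ℂ, E)) (1 : G)).mem_nhds (by simp))
  filter_upwards [h3] with z hz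
  simp only [mulChart, conjChart]
  have h4 : ofChart E G (extChartAt 𝓘(ℂ, E) (1 : G)
      (ofChart E G z.1 * ofChart E G z.2 * (ofChart E G z.1)⁻¹)) =
      ofChart E G z.1 * ofChart E G z.2 * (ofChart E G z.1)⁻¹ :=
    (extChartAt 𝓘(ℂ, E) (1 : G)).left_inv hz
  rw [h4, inv_mul_cancel_right]

/-- Write `m` for the group law in the chart. Differentiating `m(x y x⁻¹, x) = m(x, y)` in `y` at
the unit gives `Dm(1, x)(Ad x w, 0) = Dm(x, 1)(0, w)`. Differentiating this in `x` along `v` and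
using the symmetry of `D²m` gives the formula. -/
theorem fderiv_adChart_eq_sub (v w : E) :
    fderiv ℂ (adChart E G) (unitChart E G) v w =
      fderiv ℂ (fderiv ℂ (mulChart E G)) (unitChart E G, unitChart E G) (v, 0) (0, w) -
        fderiv ℂ (fderiv ℂ (mulChart E G)) (unitChart E G, unitChart E G) (w, 0) (0, v) := by
  have key : ∀ᶠ x in 𝓝 (unitChart E G),
      fderiv ℂ (mulChart E G) (unitChart E G, x) (adChart E G x w, 0) =
        fderiv ℂ (mulChart E G) (x, unitChart E G) (0, w) := by
    have hev : ∀ᶠ x in 𝓝 (unitChart E G), ∀ᶠ y in 𝓝 (unitChart E G),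
        mulChart E G (conjChart E G (x, y), x) = mulChart E G (x, y) := by
      have := eventually_mulChart_conjChart E G
      rw [nhds_prod_eq] at this
      exact this.curry
    have hsw : Tendsto (fun x : E => (unitChart E G, x)) (𝓝 (unitChart E G))
      (𝓝 (unitChart E G, unitChart E G)) := (continuous_const.prodMk continuous_id).tendsto _
    filter_upwards [hev, tendsto_prodMk_unitChart.eventually
      (eventually_differentiableAt_conjChart E G), hsw.eventually
      (eventually_differentiableAt_mulChart E G), tendsto_prodMk_unitChart.eventually
      (eventually_differentiableAt_mulChart E G), eventually_adChart_eq E G] with x h1 h2 h3 h4 h5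
    have hc : HasFDerivAt (fun y : E => (conjChart E G (x, y), x))
        ((ContinuousLinearMap.inl ℂ E E).comp (adChart E G x)) (unitChart E G) := by
      rw [h5]
      refine ((HasFDerivAt.comp (f := fun y : E => (x, y)) (unitChart E G) h2.hasFDerivAt
        (hasFDerivAt_prodMk_right _ _)).prodMk (hasFDerivAt_const x _)).congr_fderiv ?_
      ext z <;> simp
    have h3' : HasFDerivAt (mulChart E G) (fderiv ℂ (mulChart E G) (unitChart E G, x))
        (conjChart E G (x, unitChart E G), x) := by
      rw [conjChart_unitChart]
      exact h3.hasFDerivAt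
    have hl := HasFDerivAt.comp (f := fun y : E => (conjChart E G (x, y), x)) (unitChart E G) h3' hc
    have hr := HasFDerivAt.comp (f := fun y : E => (x, y)) (unitChart E G) h4.hasFDerivAt
      (hasFDerivAt_prodMk_right _ _)
    exact congrArg (fun f : E →L[ℂ] E => f w) (hl.unique (hr.congr_of_eventuallyEq h1))
  have had : HasFDerivAt (adChart E G) (fderiv ℂ (adChart E G) (unitChart E G)) (unitChart E G) :=
    ((contDiffAt_adChart E G).differentiableAt (by simp)).hasFDerivAt
  have h1 : HasFDerivAt (fun x : E => (unitChart E G, x)) (ContinuousLinearMap.inr ℂ E E)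
    (unitChart E G) := hasFDerivAt_prodMk_right _ _
  have h2 := HasFDerivAt.comp (f := fun x : E => (unitChart E G, x)) (unitChart E G)
    (differentiableAt_fderiv_mulChart E G).hasFDerivAt h1
  have h3 := h2.clm_apply ((had.clm_apply (hasFDerivAt_const w _)).prodMk
    (hasFDerivAt_const (0 : E) _))
  have h4 := congrArg (fun f : E →L[ℂ] E => f v)
    (h3.unique ((hasFDerivAt_fderiv_mulChart_left (G := G) ((0, w) : E × E)).congr_of_eventuallyEq
      key))
  have hone : adChart E G (unitChart E G) w = w := by
    have := Ad_ofChart G (unitChart E G) w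
    rw [ofChart_unitChart, Ad_one] at this
    exact this.symm
  have hsymm := ((contDiffAt_mulChart E G).isSymmSndFDerivAt (by simp)).eq (0, v) (w, 0)
  rw [← hsymm]
  simp [hone, fderiv_mulChart_unitChart] at h4
  rw [← h4]
  abel

/-- The derivative of the adjoint representation at the unit is the Lie bracket. -/
theorem bracket_eq_fderiv_adChart (v w : LieAlg E G) :
    (⁅v, w⁆ : LieAlg E G) = fderiv ℂ (adChart E G) (unitChart E G) v w :=
  (bracket_eq_fderiv_mulChart v w).trans
    (fderiv_adChart_eq_sub (E := E) (G := G) v w).symm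

variable (E G) in
theorem eventually_adChart_mulChart :
    ∀ᶠ z in 𝓝 (unitChart E G, unitChart E G),
      adChart E G (mulChart E G z) = (adChart E G z.1).comp (adChart E G z.2) := by
  have h1 : ContMDiffAt 𝓘(ℂ, E × E) 𝓘(ℂ, E) ω (fun z : E × E => ofChart E G z.1)
      (unitChart E G, unitChart E G) :=
    ContMDiffAt.comp _ (contMDiffAt_ofChart E G (unitChart_mem_target E G))
      contDiff_fst.contMDiff.contMDiffAt
  have h2 : ContMDiffAt 𝓘(ℂ, E × E) 𝓘(ℂ, E) ω (fun z : E × E => ofChart E G z.2)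
      (unitChart E G, unitChart E G) :=
    ContMDiffAt.comp _ (contMDiffAt_ofChart E G (unitChart_mem_target E G))
      contDiff_snd.contMDiff.contMDiffAt
  have h3 := (h1.mul h2).continuousAt.eventually_mem
    (s := (extChartAt 𝓘(ℂ, E) (1 : G)).source)
    ((isOpen_extChartAt_source (I := 𝓘(ℂ, E)) (1 : G)).mem_nhds (by simp))
  filter_upwards [h3] with z hz
  have h4 : ofChart E G (mulChart E G z) = ofChart E G z.1 * ofChart E G z.2 :=
    (extChartAt 𝓘(ℂ, E) (1 : G)).left_inv hz
  refine ContinuousLinearMap.ext fun v => ?_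
  have h5 := Ad_mul (ofChart E G z.1) (ofChart E G z.2) (v : LieAlg E G)
  rw [← h4] at h5
  exact h5

/-- The derivative of the adjoint representation along the left-invariant vector field of `v` is
`Ad x ∘ ad v`. -/
theorem fderiv_adChart_leftInvariant (v : E) :
    ∀ᶠ x in 𝓝 (unitChart E G),
      fderiv ℂ (adChart E G) x (fderiv ℂ (mulChart E G) (x, unitChart E G) (0, v)) =
        (adChart E G x).comp (fderiv ℂ (adChart E G) (unitChart E G) v) := by
  have hev : ∀ᶠ x in 𝓝 (unitChart E G), ∀ᶠ y in 𝓝 (unitChart E G),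
      adChart E G (mulChart E G (x, y)) = (adChart E G x).comp (adChart E G y) := by
    have := eventually_adChart_mulChart E G
    rw [nhds_prod_eq] at this
    exact this.curry
  have had : HasFDerivAt (adChart E G) (fderiv ℂ (adChart E G) (unitChart E G)) (unitChart E G) :=
    ((contDiffAt_adChart E G).differentiableAt (by simp)).hasFDerivAt
  filter_upwards [hev, (contDiffAt_adChart E G).eventually (by simp),
    tendsto_prodMk_unitChart.eventually (eventually_differentiableAt_mulChart E G),
    eventually_mulChart_right E G] with x h1 h2 h3 h4
  have h2' : HasFDerivAt (adChart E G) (fderiv ℂ (adChart E G) x)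
      (mulChart E G (x, unitChart E G)) := by
    rw [h4]
    exact (h2.differentiableAt (by simp)).hasFDerivAt
  have hl := HasFDerivAt.comp (f := fun y : E => mulChart E G (x, y)) (unitChart E G) h2'
    (HasFDerivAt.comp (f := fun y : E => (x, y)) (unitChart E G) h3.hasFDerivAt
      (hasFDerivAt_prodMk_right _ _))
  have hr := (hasFDerivAt_const (adChart E G x) (unitChart E G)).clm_comp had
  have h5 := congrArg (fun f : E →L[ℂ] (E →L[ℂ] E) => f v)
    (hl.unique (hr.congr_of_eventuallyEq h1))
  refine h5.trans ?_
  ext z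
  simp

end LocalGroupLaw

/-! ### Real smoothness of holomorphic maps -/

section RealSmoothness

/-- A complex-differentiable map is real-differentiable to the same order. -/
theorem contMDiffAt_restrictScalars {E F M N : Type*} [NormedAddCommGroup E] [NormedSpace ℂ E]
    [NormedAddCommGroup F] [NormedSpace ℂ F] [TopologicalSpace M] [ChartedSpace E M]
    [TopologicalSpace N] [ChartedSpace F N] {n : ℕ∞ω} {f : M → N} {x : M}
    (hf : ContMDiffAt 𝓘(ℂ, E) 𝓘(ℂ, F) n f x) : ContMDiffAt 𝓘(ℝ, E) 𝓘(ℝ, F) n f x := by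
  rw [contMDiffAt_iff] at hf ⊢
  exact ⟨hf.1, hf.2.restrict_scalars ℝ⟩

end RealSmoothness

/-! ### Smoothness of `Ad` and sections with prescribed values -/

section AdSmooth

open Topology Filter

variable {E : Type*} [NormedAddCommGroup E] [NormedSpace ℂ E] [FiniteDimensional ℂ E]
  {G : Type*} [TopologicalSpace G] [ChartedSpace E G] [Group G] [LieGroup 𝓘(ℂ, E) ω G]

/-- Regularity at the unit comes from the chart, and spreads to any `p` through `Ad q = Ad p ∘ Ad
(p⁻¹ q)`. -/
theorem contMDiff_Ad (ℓ : Module.Dual ℂ (LieAlg E G)) (v : LieAlg E G) :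
    ContMDiff 𝓘(ℂ, E) 𝓘(ℂ, ℂ) ω (fun p : G => ℓ (Ad p v)) := by
  have hone : ∀ ℓ : Module.Dual ℂ (LieAlg E G),
      ContMDiffAt 𝓘(ℂ, E) 𝓘(ℂ, ℂ) ω (fun p : G => ℓ (Ad p v)) 1 := by
    intro ℓ
    let ℓ' : E →L[ℂ] ℂ := LinearMap.toContinuousLinearMap (ℓ : E →ₗ[ℂ] ℂ)
    have h1 : ContDiffAt ℂ ω (fun x : E => ℓ' (adChart E G x v)) (unitChart E G) :=
      ℓ'.contDiff.contDiffAt.comp _ ((contDiffAt_adChart E G).clm_apply contDiffAt_const)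
    have h2 : ContMDiffAt 𝓘(ℂ, E) 𝓘(ℂ, ℂ) ω
        (fun p : G => ℓ' (adChart E G (extChartAt 𝓘(ℂ, E) (1 : G) p) v)) 1 :=
      ContMDiffAt.comp (f := extChartAt 𝓘(ℂ, E) (1 : G))
        (g := fun x : E => ℓ' (adChart E G x v)) (1 : G) h1.contMDiffAt contMDiffAt_extChartAt
    refine h2.congr_of_eventuallyEq ?_
    filter_upwards [extChartAt_source_mem_nhds (I := 𝓘(ℂ, E)) (1 : G)] with p hp
    have h3 := Ad_ofChart G (extChartAt 𝓘(ℂ, E) (1 : G) p) v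
    have h4 : ofChart E G (extChartAt 𝓘(ℂ, E) (1 : G) p) = p :=
      (extChartAt 𝓘(ℂ, E) (1 : G)).left_inv hp
    rw [h4] at h3
    exact congrArg ℓ h3
  intro p
  have h1 : ContMDiffAt 𝓘(ℂ, E) 𝓘(ℂ, ℂ) ω
      (fun q : G => (ℓ ∘ₗ Ad p) (Ad (p⁻¹ * q) v)) p := by
    refine ContMDiffAt.comp_of_eq (g := fun q : G => (ℓ ∘ₗ Ad p) (Ad q v)) (hone _)
      (contMDiff_mul_left (I := 𝓘(ℂ, E)) (n := ω) (a := p⁻¹)).contMDiffAt (by simp)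
  refine h1.congr_of_eventuallyEq (Eventually.of_forall fun q => ?_)
  simp only [LinearMap.comp_apply]
  rw [← Ad_mul, mul_inv_cancel_left]

variable [CompleteSpace E] [LieAlgebra.IsSimple ℂ (LieAlg E G)]
  {H : LieSubalgebra ℂ (LieAlg E G)} [H.IsCartanSubalgebra]

/-- The section `p ↦ Ad(p)⁻¹ w` of `G × 𝔤/B`. -/
def invSection (Δ : (LieAlgebra.IsKilling.rootSystem H).Base) (w : LieAlg E G) :
    SmoothSection E (adAction Δ) where
  toFun p := Ad p⁻¹ w
  smooth ℓ p := by
    refine contMDiffAt_restrictScalars ?_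
    exact (((contMDiff_Ad ℓ w).comp (contMDiff_inv 𝓘(ℂ, E) ω)).contMDiffAt).of_le le_top
  equivariant p b := by
    change Ad (b : G) (Ad (p * b)⁻¹ w) = _
    rw [← Ad_mul, mul_inv_rev, mul_inv_cancel_left]

/-- As `Ad` is defined on all of `G`, the bundle `G × 𝔤/B` is trivialized by the sections `p ↦
Ad(p)⁻¹ w`. This turns identities between sections into pointwise ones. -/
theorem exists_section_apply_eq (Δ : (LieAlgebra.IsKilling.rootSystem H).Base) (p : G)
    (v : LieAlg E G) : ∃ s : SmoothSection E (adAction Δ), s p = v :=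
  ⟨invSection Δ (Ad p v), by
    change Ad p⁻¹ (Ad p v) = v
    rw [← Ad_mul, inv_mul_cancel, Ad_one]; rfl⟩

end AdSmooth

/-! ### Integral curves of left-invariant fields and exponentials of `ad` -/

section OneParameter

open Topology Filter

variable {E : Type*} [NormedAddCommGroup E] [NormedSpace ℂ E] [CompleteSpace E]
  {G : Type*} [TopologicalSpace G] [ChartedSpace E G] [Group G] [LieGroup 𝓘(ℂ, E) ω G]

theorem exp_neg_mul_exp {𝔸 : Type*} [NormedRing 𝔸] [NormedAlgebra ℝ 𝔸] [CompleteSpace 𝔸] (x : 𝔸) :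
    NormedSpace.exp (-x) * NormedSpace.exp x = 1 := by
  rw [← NormedSpace.exp_add_of_commute_of_mem_ball (𝕂 := ℝ) (Commute.refl x).neg_left
    ((NormedSpace.expSeries_radius_eq_top ℝ 𝔸).symm ▸ edist_lt_top _ _)
    ((NormedSpace.expSeries_radius_eq_top ℝ 𝔸).symm ▸ edist_lt_top _ _),
    neg_add_cancel, NormedSpace.exp_zero]

/-- The integral curve of the left-invariant vector field of `v` through the unit, for small times:
the adjoint representation along it is `exp (t ad v)`. -/
theorem exists_Ad_eq_exp (v : E) : ∃ γ : ℝ → G, ∀ᶠ t : ℝ in 𝓝 0, ∀ w : E,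
    (Ad (γ t) (w : LieAlg E G) : E) =
      NormedSpace.exp (t • fderiv ℂ (adChart E G) (unitChart E G) v) w := by
  set A : E →L[ℂ] E := fderiv ℂ (adChart E G) (unitChart E G) v with hA
  have hw : ContDiffAt ℂ 1 (fun x : E => fderiv ℂ (mulChart E G) (x, unitChart E G) (0, v))
      (unitChart E G) := by
    have h1 : ContDiffAt ℂ 1 (fderiv ℂ (mulChart E G)) (unitChart E G, unitChart E G) :=
      (contDiffAt_mulChart E G).fderiv_right (by simp)
    exact (ContDiffAt.comp (f := fun x : E => (x, unitChart E G)) (unitChart E G) h1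
      (contDiffAt_id.prodMk contDiffAt_const)).clm_apply contDiffAt_const
  -- Local existence for the ODE of the left-invariant field in the chart; a global exponential map
  -- of `G` is not needed.
  obtain ⟨c, hc0, ε, hε, hc⟩ :=
    ContDiffAt.exists_forall_mem_closedBall_exists_eq_forall_mem_Ioo_hasDerivAt₀
    (hw.restrict_scalars ℝ) 0
  rw [zero_sub, zero_add] at hc
  have hcont : Tendsto c (𝓝 0) (𝓝 (unitChart E G)) := by
    have := (hc 0 ⟨neg_lt_zero.mpr hε, hε⟩).continuousAt.tendsto
    rwa [hc0] at this
  have hgood := hcont.eventually ((fderiv_adChart_leftInvariant (G := G) v).and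
    ((contDiffAt_adChart E G).eventually (by simp)))
  obtain ⟨δ, hδ, hball⟩ := Metric.eventually_nhds_iff_ball.mp
    (hgood.and (Ioo_mem_nhds (neg_lt_zero.mpr hε) hε))
  refine ⟨fun t => ofChart E G (c t), ?_⟩
  have hP : ∀ t ∈ Metric.ball (0 : ℝ) δ,
      HasDerivAt (fun t => adChart E G (c t)) ((adChart E G (c t)).comp A) t := by
    intro t ht
    obtain ⟨⟨h1, h2⟩, h3⟩ := hball t ht
    have h4 := ((h2.differentiableAt (by simp)).hasFDerivAt.restrictScalars ℝ).comp_hasDerivAt t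
      (hc t h3)
    exact h4.congr_deriv h1
  -- Along the curve `P' = P A` for `P = Ad(γ t)`, so `P exp(-tA)` is constant.
  have hQ : ∀ t ∈ Metric.ball (0 : ℝ) δ,
      HasDerivAt (fun t : ℝ => adChart E G (c t) * NormedSpace.exp (t • (-A))) 0 t := by
    intro t ht
    have h1 := hasDerivAt_exp_smul_const' (𝕂 := ℝ) (-A) t
    refine ((hP t ht).mul h1).congr_deriv ?_
    change (adChart E G (c t) * A) * _ + _ = _
    rw [neg_mul, mul_neg, mul_assoc, add_neg_cancel]
  have hconst : ∀ t ∈ Metric.ball (0 : ℝ) δ,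
      adChart E G (c t) * NormedSpace.exp (t • (-A)) = 1 := by
    intro t ht
    have h1 := Metric.isOpen_ball.is_const_of_deriv_eq_zero
      (convex_ball (0 : ℝ) δ).isPreconnected
      (fun s hs => (hQ s hs).differentiableAt.differentiableWithinAt)
      (fun s hs => (hQ s hs).deriv) ht (Metric.mem_ball_self hδ)
    refine h1.trans ?_
    rw [hc0, zero_smul, NormedSpace.exp_zero, mul_one]
    ext w
    have h2 := Ad_ofChart G (unitChart E G) (w : LieAlg E G)
    rw [ofChart_unitChart, Ad_one] at h2
    exact h2.symm
  filter_upwards [Metric.ball_mem_nhds (0 : ℝ) hδ] with t ht w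
  have h1 : adChart E G (c t) = NormedSpace.exp (t • A) := by
    have h2 : NormedSpace.exp (t • (-A)) * NormedSpace.exp (t • A) = 1 := by
      rw [smul_neg]
      exact exp_neg_mul_exp _
    calc adChart E G (c t)
        = adChart E G (c t) * (NormedSpace.exp (t • (-A)) * NormedSpace.exp (t • A)) := by
          rw [h2, mul_one]
      _ = NormedSpace.exp (t • A) := by rw [← mul_assoc, hconst t ht, one_mul]
  rw [← h1]
  rfl

/-- A closed invariant subspace of `A` is invariant under `exp A`. -/
theorem exp_apply_mem {S : Submodule ℂ E} (hS : IsClosed (S : Set E)) {A : E →L[ℂ] E}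
    (hA : ∀ x ∈ S, A x ∈ S) {x : E} (hx : x ∈ S) : NormedSpace.exp A x ∈ S := by
  have h1 := NormedSpace.exp_series_hasSum_exp' (𝕂 := ℂ) A
  have h2 := h1.mapL (ContinuousLinearMap.apply ℂ E x)
  have hpow : ∀ n : ℕ, (A ^ n) x ∈ S := by
    intro n
    induction n with
    | zero => simpa using hx
    | succ n ih =>
      rw [pow_succ']
      exact hA _ ih
  refine hS.mem_of_tendsto h2 (Eventually.of_forall fun s => ?_)
  refine S.sum_mem fun n _ => ?_
  simpa using S.smul_mem _ (hpow n)

theorem hasDerivAt_exp_smul_apply (A : E →L[ℂ] E) (w : E) (ℓ : E →L[ℂ] ℂ) :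
    HasDerivAt (fun t : ℝ => ℓ (NormedSpace.exp (t • A) w)) (ℓ (A w)) 0 := by
  have h1 := hasDerivAt_exp_smul_const' (𝕂 := ℝ) A 0
  rw [zero_smul, NormedSpace.exp_zero, mul_one] at h1
  exact ((ℓ.comp (ContinuousLinearMap.apply ℂ E w)).restrictScalars
    ℝ).hasFDerivAt.comp_hasDerivAt 0 h1

end OneParameter

/-! ### Stability of the filtration under negative root vectors -/

section BorelStable

open Topology Filter LieAlgebra LieAlgebra.IsKilling

variable {E : Type*} [NormedAddCommGroup E] [NormedSpace ℂ E] [FiniteDimensional ℂ E]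
  [CompleteSpace E]
  {G : Type*} [TopologicalSpace G] [ChartedSpace E G] [Group G] [LieGroup 𝓘(ℂ, E) ω G]
  [LieAlgebra.IsSimple ℂ (LieAlg E G)]
  {H : LieSubalgebra ℂ (LieAlg E G)} [H.IsCartanSubalgebra]
  {Δ : (LieAlgebra.IsKilling.rootSystem H).Base}

theorem NegRoot.space_le_borelSubalgebra (α : NegRoot Δ) : α.space ≤ borelSubalgebra Δ :=
  le_sup_of_le_right (le_iSup (fun α : NegRoot Δ => α.space) α)

/-- Heights add, so a root that is a sum of two negative roots is negative. -/
theorem lie_mem_borelSubalgebra (α : NegRoot Δ) {y : LieAlg E G} (hy : y ∈ α.space)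
    {x : LieAlg E G} (hx : x ∈ borelSubalgebra Δ) : ⁅y, x⁆ ∈ borelSubalgebra Δ := by
  have hmap : borelSubalgebra Δ ≤
      (borelSubalgebra Δ).comap (LieAlgebra.ad ℂ (LieAlg E G) y) := by
    refine sup_le ?_ (iSup_le fun β => ?_)
    · intro h hh
      rw [Submodule.mem_comap, LieAlgebra.ad_apply, ← lie_skew]
      refine Submodule.neg_mem _ (α.space_le_borelSubalgebra ?_)
      have h1 : ⁅h, y⁆ = (α.1.1 : H → ℂ) ⟨h, hh⟩ • y := lie_eq_smul_of_mem_rootSpace hy ⟨h, hh⟩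
      rw [h1]
      exact Submodule.smul_mem _ _ hy
    · intro x hx
      rw [Submodule.mem_comap, LieAlgebra.ad_apply]
      have h1 : ⁅y, x⁆ ∈ rootSpace H ((α.1.1 : H → ℂ) + (β.1.1 : H → ℂ)) :=
        lie_mem_genWeightSpace_of_mem_genWeightSpace hy hx
      by_cases h0 : ⁅y, x⁆ = 0
      · rw [h0]; exact Submodule.zero_mem _
      have hne : rootSpace H ((α.1.1 : H → ℂ) + (β.1.1 : H → ℂ)) ≠ ⊥ := by
        intro h
        rw [h] at h1
        exact h0 (by simpa using h1)
      let γ : LieModule.Weight ℂ H (LieAlg E G) := ⟨(α.1.1 : H → ℂ) + (β.1.1 : H → ℂ), hne⟩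
      -- The case `α + β = 0` need not be excluded: the bracket then lies in `H`, which is part of
      -- `𝔟`.
      by_cases hγ : γ.IsZero
      · refine (le_sup_left : H.toSubmodule ≤ _) ?_
        have h2 : (α.1.1 : H → ℂ) + (β.1.1 : H → ℂ) = 0 := hγ
        rw [h2, rootSpace_zero_eq] at h1
        exact h1
      · have hmem : γ ∈ H.root := by simpa using hγ
        have hsum : (rootSystem H).root ⟨γ, hmem⟩ =
            (rootSystem H).root α.1 + (rootSystem H).root β.1 := by
          ext h
          rfl
        have hh := Δ.height_add hsum
        refine NegRoot.space_le_borelSubalgebra (⟨⟨γ, hmem⟩, ?_⟩ : NegRoot Δ) h1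
        rw [hh]
        exact add_neg α.2 β.2
  exact hmap hx

/-- The exponential curve of a negative root vector lies in the Borel subgroup for small times. -/
theorem exists_borel_eq_exp (α : NegRoot Δ) {y : LieAlg E G} (hy : y ∈ α.space) :
    ∃ γ : ℝ → G, ∀ᶠ t : ℝ in 𝓝 0, γ t ∈ borel Δ ∧ ∀ w : E,
    (Ad (γ t) (w : LieAlg E G) : E) =
      NormedSpace.exp (t • fderiv ℂ (adChart E G) (unitChart E G) y) w := by
  obtain ⟨γ, hγ⟩ := exists_Ad_eq_exp (E := E) (G := G) y
  refine ⟨γ, hγ.mono fun t ht => ⟨?_, ht⟩⟩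
  set A : E →L[ℂ] E := fderiv ℂ (adChart E G) (unitChart E G) y with hA
  let S : Submodule ℂ E := borelSubalgebra Δ
  have hS : IsClosed (S : Set E) := S.closed_of_finiteDimensional
  have hAS : ∀ x ∈ S, A x ∈ S := by
    intro (x : LieAlg E G) hx
    have h1 := lie_mem_borelSubalgebra α hy hx
    rw [bracket_eq_fderiv_adChart] at h1
    exact h1
  have hexp : ∀ (s : ℝ), ∀ x ∈ S, NormedSpace.exp (s • A) x ∈ S := by
    intro s x hx
    refine exp_apply_mem hS (fun x hx => ?_) hx
    have : (s • A) x = (s : ℂ) • A x := by simp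
    rw [this]
    exact S.smul_mem _ (hAS x hx)
  intro X
  have hX := ht X
  constructor
  -- Membership in the normalizer is an equivalence; this direction uses the inverse `exp(-tA)`,
  -- which also preserves `𝔟`.
  · intro h
    have h1 : NormedSpace.exp (t • A) X ∈ S := by rw [← hX]; exact h
    have h2 := hexp (-t) _ h1
    have h3 : NormedSpace.exp (-t • A) * NormedSpace.exp (t • A) = 1 := by
      rw [neg_smul]; exact exp_neg_mul_exp _
    have h4 : NormedSpace.exp (-t • A) (NormedSpace.exp (t • A) X) = X :=
      congrArg (fun f : E →L[ℂ] E => f X) h3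
    rw [h4] at h2
    exact h2
  · intro h
    have h1 := hexp t X h
    rw [← hX] at h1
    exact h1

/-- The filtration is stable under negative root vectors. -/
theorem BFiltration.coord_lie_eq_zero (F : BFiltration Δ) (α : NegRoot Δ) {y : LieAlg E G}
    (hy : y ∈ α.space) {j k : Fin (Module.finrank ℂ (LieAlg E G))} (hjk : j < k) :
    F.e.coord k ⁅y, F.e j⁆ = 0 := by
  obtain ⟨γ, hγ⟩ := exists_borel_eq_exp α hy
  set A : E →L[ℂ] E := fderiv ℂ (adChart E G) (unitChart E G) y with hA
  let ℓ : E →L[ℂ] ℂ := LinearMap.toContinuousLinearMap (F.e.coord k : E →ₗ[ℂ] ℂ)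
  have hev : (fun t : ℝ => ℓ (NormedSpace.exp (t • A) (F.e j))) =ᶠ[𝓝 0] fun _ => 0 := by
    filter_upwards [hγ] with t ht
    rw [← ht.2 (F.e j)]
    -- Indices start at `0`, so `F_{j+1}` is the first step containing `e j`, and coordinate `k > j`
    -- vanishes on it.
    have h1 := F.stable (j.val + 1) ⟨γ t, ht.1⟩ (F.e j)
      (Submodule.subset_span ⟨j, Nat.lt_succ_self _, rfl⟩)
    have h2 : Submodule.span ℂ (F.e '' {i | i.val < j.val + 1}) ≤ LinearMap.ker (F.e.coord k) := by
      rw [Submodule.span_le]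
      rintro _ ⟨i, hi, rfl⟩
      have hik : i ≠ k := by
        rintro rfl
        have := Fin.lt_def.mp hjk
        simp only [Set.mem_ofPred_eq] at hi
        omega
      simp [hik]
    exact h2 h1
  have h0 := ((hasDerivAt_exp_smul_apply (E := E) A (F.e j) ℓ).congr_of_eventuallyEq
    hev.symm).unique (hasDerivAt_const (0 : ℝ) (0 : ℂ))
  rw [bracket_eq_fderiv_adChart]
  exact h0

/-- The components of an element acting by strictly triangular matrices lie in negative root
spaces. -/
theorem BFiltration.exists_negRoot_of_coord_ne_zero (F : BFiltration Δ) {a : LieAlg E G}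
    (ha : ∀ j k, j ≤ k → F.e.coord k ⁅a, F.e j⁆ = 0)
    {i : Fin (Module.finrank ℂ (LieAlg E G))} (hi : F.e.coord i a ≠ 0) :
    ∃ α : NegRoot Δ, F.weight i = (α.1.1 : H → ℂ) := by
  have hw := weight_ne_zero_of_coord_ne_zero F.e_mem ha hi
  have hne : rootSpace H (F.weight i) ≠ ⊥ := by
    intro h
    have := F.e_mem i
    rw [h] at this
    exact F.e.ne_zero i (by simpa using this)
  let χ : LieModule.Weight ℂ H (LieAlg E G) := ⟨F.weight i, hne⟩
  have hχ : χ.IsNonZero := hw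
  have hmem : χ ∈ H.root := by simpa using hχ
  by_cases hneg : Δ.height ⟨χ, hmem⟩ < 0
  · exact ⟨⟨⟨χ, hmem⟩, hneg⟩, rfl⟩
  exfalso
  have hmem' : -χ ∈ H.root := by simpa using hχ
  -- Writing `-χ = χ + (-2)χ` gives height `-height χ`, which is negative because heights of roots
  -- are nonzero.
  have hsum : (rootSystem H).root ⟨-χ, hmem'⟩ =
      (rootSystem H).root ⟨χ, hmem⟩ + (-2 : ℤ) • (rootSystem H).root ⟨χ, hmem⟩ := by
    rw [← one_smul ℤ ((rootSystem H).root ⟨χ, hmem⟩), smul_smul, ← add_smul]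
    norm_num
  have hh := Δ.height_add_zsmul hsum
  have hh0 := Δ.height_ne_zero ⟨χ, hmem⟩
  rw [smul_eq_mul] at hh
  let β : NegRoot Δ := ⟨⟨-χ, hmem'⟩, by omega⟩
  exact weight_ne_of_coord_ne_zero F.e_mem ha hχ
    (fun y hy j k hjk => F.coord_lie_eq_zero β hy hjk) hi rfl

end BorelStable

/-! ### Leibniz rule for the scalar Cauchy-Riemann operator -/

section Dbar

variable {E : Type*} [NormedAddCommGroup E] [NormedSpace ℂ E]
  {G : Type*} [TopologicalSpace G] [ChartedSpace E G] [Group G]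

theorem contMDiff_mul_complex {f g : G → ℂ} (hf : ContMDiff 𝓘(ℝ, E) 𝓘(ℝ, ℂ) ∞ f)
    (hg : ContMDiff 𝓘(ℝ, E) 𝓘(ℝ, ℂ) ∞ g) :
    ContMDiff 𝓘(ℝ, E) 𝓘(ℝ, ℂ) ∞ (fun q => f q * g q) := by
  have hm : ContDiff ℝ ∞ (fun z : ℂ × ℂ => z.1 * z.2) := contDiff_fst.mul contDiff_snd
  exact hm.contMDiff.comp (hf.prodMk_space hg)

variable [LieGroup 𝓘(ℂ, E) ω G]

theorem mdifferentiableAt_leftTranslate {f : G → ℂ} (hf : ContMDiff 𝓘(ℝ, E) 𝓘(ℝ, ℂ) ∞ f) (p : G) :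
    MDifferentiableAt 𝓘(ℝ, E) 𝓘(ℝ, ℂ) (fun y : G => f (p * y)) 1 := by
  have h1 : ContMDiffAt 𝓘(ℝ, E) 𝓘(ℝ, E) ∞ (fun y : G => p * y) 1 :=
    (contMDiffAt_restrictScalars
      (contMDiff_mul_left (I := 𝓘(ℂ, E)) (n := ω) (a := p)).contMDiffAt).of_le le_top
  exact (ContMDiffAt.comp (f := fun y : G => p * y) (1 : G) hf.contMDiffAt h1).mdifferentiableAt
    (by simp)

theorem differentiableAt_comp_ofChart {f : G → ℂ} (hf : ContMDiff 𝓘(ℝ, E) 𝓘(ℝ, ℂ) ∞ f) (p : G) :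
    DifferentiableAt ℝ (fun x : E => f (p * ofChart E G x)) (unitChart E G) := by
  have h := (mdifferentiableAt_leftTranslate hf p).differentiableWithinAt_writtenInExtChartAt
  rw [modelWithCornersSelf_coe, Set.range_id, differentiableWithinAt_univ] at h
  exact h

/-- Reduces derivatives along left-invariant fields to ordinary derivatives on `E`, where the
product and sum rules are available. -/
theorem leftDeriv_eq_fderiv {f : G → ℂ} (hf : ContMDiff 𝓘(ℝ, E) 𝓘(ℝ, ℂ) ∞ f) (p : G)
    (X : LieAlg E G) : leftDeriv f p X =
      fderiv ℝ (fun x : E => f (p * ofChart E G x)) (unitChart E G) X := by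
  have h := (mdifferentiableAt_leftTranslate hf p).mfderiv
  rw [modelWithCornersSelf_coe, Set.range_id, fderivWithin_univ] at h
  exact congrArg (fun L : E →L[ℝ] ℂ => L X) h

theorem leftDeriv_mul {f g : G → ℂ} (hf : ContMDiff 𝓘(ℝ, E) 𝓘(ℝ, ℂ) ∞ f)
    (hg : ContMDiff 𝓘(ℝ, E) 𝓘(ℝ, ℂ) ∞ g) (p : G) (X : LieAlg E G) :
    leftDeriv (fun q => f q * g q) p X = leftDeriv f p X * g p + f p * leftDeriv g p X := by
  rw [leftDeriv_eq_fderiv (contMDiff_mul_complex hf hg), leftDeriv_eq_fderiv hf,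
    leftDeriv_eq_fderiv hg]
  have h := ((differentiableAt_comp_ofChart hf p).hasFDerivAt.mul
    (differentiableAt_comp_ofChart hg p).hasFDerivAt).fderiv
  have h1 : ∀ Y : E, fderiv ℝ ((fun x => f (p * ofChart E G x)) * fun x => g (p * ofChart E G x))
      (unitChart E G) Y = fderiv ℝ (fun x => f (p * ofChart E G x)) (unitChart E G) Y * g p +
        f p * fderiv ℝ (fun x => g (p * ofChart E G x)) (unitChart E G) Y := by
    intro Y
    rw [h]
    simp
    ring
  exact h1 X

theorem leftDeriv_sum {ι : Type*} (s : Finset ι) {f : ι → G → ℂ}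
    (hf : ∀ i, ContMDiff 𝓘(ℝ, E) 𝓘(ℝ, ℂ) ∞ (f i)) (p : G) (X : LieAlg E G) :
    leftDeriv (fun q => ∑ i ∈ s, f i q) p X = ∑ i ∈ s, leftDeriv (f i) p X := by
  rw [leftDeriv_eq_fderiv (contMDiff_finsetSum fun i _ => hf i)]
  simp_rw [leftDeriv_eq_fderiv (hf _)]
  have h := (HasFDerivAt.fun_sum (u := s)
    fun i _ => (differentiableAt_comp_ofChart (hf i) p).hasFDerivAt).fderiv
  have h1 : ∀ Y : E, fderiv ℝ (fun x => ∑ i ∈ s, f i (p * ofChart E G x)) (unitChart E G) Y =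
      ∑ i ∈ s, fderiv ℝ (fun x => f i (p * ofChart E G x)) (unitChart E G) Y := by
    intro Y
    rw [h, sum_apply]
  exact h1 X

theorem leftDeriv_const (c : ℂ) (p : G) (X : LieAlg E G) :
    leftDeriv (fun _ => c) p X = 0 := by
  rw [leftDeriv_eq_fderiv contMDiff_const]
  exact congrArg (fun L : E →L[ℝ] ℂ => L X) (hasFDerivAt_const (𝕜 := ℝ) c (unitChart E G)).fderiv

theorem dbar_mul {f g : G → ℂ} (hf : ContMDiff 𝓘(ℝ, E) 𝓘(ℝ, ℂ) ∞ f)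
    (hg : ContMDiff 𝓘(ℝ, E) 𝓘(ℝ, ℂ) ∞ g) (p : G) (X : LieAlg E G) :
    dbar (fun q => f q * g q) p X = dbar f p X * g p + f p * dbar g p X := by
  rw [dbar, dbar, dbar, leftDeriv_mul hf hg, leftDeriv_mul hf hg]
  ring

theorem dbar_sum {ι : Type*} (s : Finset ι) {f : ι → G → ℂ}
    (hf : ∀ i, ContMDiff 𝓘(ℝ, E) 𝓘(ℝ, ℂ) ∞ (f i)) (p : G) (X : LieAlg E G) :
    dbar (fun q => ∑ i ∈ s, f i q) p X = ∑ i ∈ s, dbar (f i) p X := by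
  simp only [dbar]
  rw [leftDeriv_sum s hf, leftDeriv_sum s hf, Finset.mul_sum, ← Finset.sum_add_distrib,
    Finset.mul_sum]

theorem dbar_mul_const {f : G → ℂ} (hf : ContMDiff 𝓘(ℝ, E) 𝓘(ℝ, ℂ) ∞ f) (c : ℂ)
    (p : G) (X : LieAlg E G) : dbar (fun q => f q * c) p X = dbar f p X * c := by
  rw [dbar_mul hf contMDiff_const]
  simp [dbar, leftDeriv_const]

end Dbar

/-! ### Derivations of the bracket of sections -/

section Operators

open LieAlgebra LieAlgebra.IsKilling

variable {E : Type*} [NormedAddCommGroup E] [NormedSpace ℂ E] [FiniteDimensional ℂ E]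
  [CompleteSpace E]
  {G : Type*} [TopologicalSpace G] [ChartedSpace E G] [Group G] [LieGroup 𝓘(ℂ, E) ω G]
  [LieAlgebra.IsSimple ℂ (LieAlg E G)]
  {H : LieSubalgebra ℂ (LieAlg E G)} [H.IsCartanSubalgebra]
  {Δ : (LieAlgebra.IsKilling.rootSystem H).Base} {F : BFiltration Δ}

theorem coord_lie {ι : Type*} [Fintype ι] (e : Module.Basis ι ℂ (LieAlg E G))
    (x y : LieAlg E G) (k : ι) :
    e.coord k ⁅x, y⁆ = ∑ i, ∑ j, e.coord i x * e.coord j y * e.coord k ⁅e i, e j⁆ := by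
  conv_lhs => rw [← e.sum_repr x, ← e.sum_repr y, sum_lie_sum]
  simp only [map_sum, smul_lie, lie_smul, map_smul, smul_eq_mul, Module.Basis.coord_apply]
  exact Finset.sum_congr rfl fun i _ => Finset.sum_congr rfl fun j _ => by ring

theorem BFiltration.coord_dbarZero (F : BFiltration Δ) (t : G → LieAlg E G) (p : G)
    (X : LieAlg E G) (k : Fin (Module.finrank ℂ (LieAlg E G))) :
    F.e.coord k (F.dbarZero t p X) = dbar (fun q => F.e.coord k (t q)) p X := by
  rw [BFiltration.dbarZero, map_sum, Finset.sum_eq_single k]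
  · simp
  · intro i _ hik
    simp [hik]
  · simp

/-- The structure constants in the basis `e` are constant functions, so this is the scalar Leibniz
rule summed over coordinates. -/
theorem BFiltration.dbarZero_lie (F : BFiltration Δ) {t u : G → LieAlg E G}
    (ht : IsSmooth (E := E) t) (hu : IsSmooth (E := E) u) (p : G) (X : LieAlg E G) :
    F.dbarZero (fun q => ⁅t q, u q⁆) p X =
      ⁅F.dbarZero t p X, u p⁆ + ⁅t p, F.dbarZero u p X⁆ := by
  refine F.e.ext_elem fun k => ?_
  have hm : ∀ i j, ContMDiff 𝓘(ℝ, E) 𝓘(ℝ, ℂ) ∞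
      (fun q : G => F.e.coord i (t q) * F.e.coord j (u q)) :=
    fun i j => contMDiff_mul_complex (ht _) (hu _)
  have hmc : ∀ i j, ContMDiff 𝓘(ℝ, E) 𝓘(ℝ, ℂ) ∞
      (fun q : G => F.e.coord i (t q) * F.e.coord j (u q) * F.e.coord k ⁅F.e i, F.e j⁆) :=
    fun i j => contMDiff_mul_complex (hm i j) contMDiff_const
  have h1 : F.e.coord k (F.dbarZero (fun q => ⁅t q, u q⁆) p X) =
      F.e.coord k ⁅F.dbarZero t p X, u p⁆ + F.e.coord k ⁅t p, F.dbarZero u p X⁆ := by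
    rw [F.coord_dbarZero, coord_lie F.e (F.dbarZero t p X), coord_lie F.e (t p),
      ← Finset.sum_add_distrib]
    simp_rw [coord_lie F.e (t _) (u _)]
    rw [dbar_sum _ fun i => contMDiff_finsetSum fun j _ => hmc i j]
    refine Finset.sum_congr rfl fun i _ => ?_
    rw [dbar_sum _ fun j => hmc i j, ← Finset.sum_add_distrib]
    refine Finset.sum_congr rfl fun j _ => ?_
    rw [dbar_mul_const (hm i j), dbar_mul (ht _) (hu _), F.coord_dbarZero, F.coord_dbarZero]
    ring
  rw [← map_add] at h1
  exact h1

theorem BFiltration.SmoothSplitting.isSmooth_apply (Θ : F.SmoothSplitting)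
    (s : SmoothSection E (adAction Δ)) : IsSmooth (E := E) (fun q => Θ q (s q)) := by
  intro ℓ
  have h : (fun q : G => ℓ (Θ q (s q))) =
      fun q => ∑ i, F.e.coord i (s q) * ℓ (Θ q (F.e i)) := by
    funext q
    conv_lhs => rw [← F.e.sum_repr (s q), map_sum, map_sum]
    simp
  rw [h]
  exact contMDiff_finsetSum fun i _ => contMDiff_mul_complex (s.smooth _) (Θ.smooth _ _)

/-- An operator `∂̄₀ + A`, with `A` of order zero, is a derivation of the bracket of sections if and
only if the values of `A` are derivations of `𝔤`. -/
theorem preservesBracket_iff (Θ : F.SmoothSplitting)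
    (D : SmoothSection E (adAction Δ) → Form01 (borelSubalgebra Δ) (adAction Δ))
    (A : G → LieAlg E G → Module.End ℂ (LieAlg E G))
    (hA : ∀ (s : SmoothSection E (adAction Δ)) (p : G) (X : LieAlg E G),
      Θ p (D s p X) = F.dbarZero (fun q => Θ q (s q)) p X + A p X (Θ p (s p))) :
    PreservesBracket D ↔ ∀ (p : G) (X u v : LieAlg E G),
      A p X ⁅u, v⁆ = ⁅A p X u, v⁆ + ⁅u, A p X v⁆ := by
  -- Apply the Lie isomorphism `Θ p` to both sides; the `∂̄₀` terms cancel and only the zero-order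
  -- part remains.
  have key : ∀ (s t : SmoothSection E (adAction Δ)) (p : G) (X : LieAlg E G),
      D (s.bracket t) p X = ⁅D s p X, t p⁆ + ⁅s p, D t p X⁆ ↔
      A p X ⁅Θ p (s p), Θ p (t p)⁆ =
        ⁅A p X (Θ p (s p)), Θ p (t p)⁆ + ⁅Θ p (s p), A p X (Θ p (t p))⁆ := by
    intro s t p X
    have hinj : ∀ x y, Θ p x = Θ p y ↔ x = y := fun x y => (Θ p).injective.eq_iff
    rw [← hinj, hA, map_add, LieEquiv.map_lie, LieEquiv.map_lie, hA, hA]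
    have h1 : (fun q => Θ q (s.bracket t q)) = fun q => ⁅Θ q (s q), Θ q (t q)⁆ :=
      funext fun q => (Θ q).map_lie _ _
    have h2 : Θ p (s.bracket t p) = ⁅Θ p (s p), Θ p (t p)⁆ := (Θ p).map_lie _ _
    rw [h1, h2, F.dbarZero_lie (Θ.isSmooth_apply s) (Θ.isSmooth_apply t), add_lie, lie_add]
    constructor
    · intro h
      refine add_left_cancel (a := ⁅F.dbarZero (fun q => Θ q (s q)) p X, Θ p (t p)⁆ +
        ⁅Θ p (s p), F.dbarZero (fun q => Θ q (t q)) p X⁆) (h.trans ?_)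
      abel
    · intro h
      rw [h]
      abel
  constructor
  · intro h p X u v
    obtain ⟨s, hs⟩ := exists_section_apply_eq Δ p ((Θ p).symm u)
    obtain ⟨t, ht⟩ := exists_section_apply_eq Δ p ((Θ p).symm v)
    have h1 := (key s t p X).mp (h s t p X)
    rw [hs, ht, LieEquiv.apply_symm_apply, LieEquiv.apply_symm_apply] at h1
    exact h1
  · exact fun h s t p X => (key s t p X).mpr (h _ _ _ _)

end Operators

/-! ### The graded action of `B` and weight projections -/

section GradedAction

open LieAlgebra LieAlgebra.IsKilling

variable {E : Type*} [NormedAddCommGroup E] [NormedSpace ℂ E] [FiniteDimensional ℂ E]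
  [CompleteSpace E]
  {G : Type*} [TopologicalSpace G] [ChartedSpace E G] [Group G] [LieGroup 𝓘(ℂ, E) ω G]
  [LieAlgebra.IsSimple ℂ (LieAlg E G)]
  {H : LieSubalgebra ℂ (LieAlg E G)} [H.IsCartanSubalgebra]
  {Δ : (LieAlgebra.IsKilling.rootSystem H).Base} {F : BFiltration Δ}

theorem BFiltration.gradedAction_basis (F : BFiltration Δ) (b : borel Δ)
    (i : Fin (Module.finrank ℂ (LieAlg E G))) :
    F.gradedAction b (F.e i) = F.char i b • F.e i :=
  F.e.constr_basis ℂ _ i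

/-- Equivariance of `Θ` at the unit exhibits the graded action as a composite of Lie automorphisms;
hence it respects brackets and its characters do not vanish. -/
theorem BFiltration.SmoothSplitting.gradedAction_eq (Θ : F.SmoothSplitting) (b : borel Δ)
    (x : LieAlg E G) :
    F.gradedAction b x = Θ 1 (Ad (b : G) ((Θ (1 * b)).symm x)) := by
  rw [← Θ.equivariant, LieEquiv.apply_symm_apply]

theorem BFiltration.SmoothSplitting.gradedAction_lie (Θ : F.SmoothSplitting) (b : borel Δ)
    (x y : LieAlg E G) :
    F.gradedAction b ⁅x, y⁆ = ⁅F.gradedAction b x, F.gradedAction b y⁆ := by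
  rw [Θ.gradedAction_eq, Θ.gradedAction_eq, Θ.gradedAction_eq, LieEquiv.map_lie, Ad_lie,
    LieEquiv.map_lie]

theorem BFiltration.SmoothSplitting.char_ne_zero (Θ : F.SmoothSplitting) (b : borel Δ)
    (i : Fin (Module.finrank ℂ (LieAlg E G))) : F.char i b ≠ 0 := by
  intro h
  have h1 := F.gradedAction_basis b i
  rw [h, zero_smul, Θ.gradedAction_eq] at h1
  have h2 : Ad (b : G) ((Θ (1 * b)).symm (F.e i)) = 0 := (Θ 1).injective (h1.trans (map_zero _).symm)
  have h3 := congrArg (Ad (b : G)⁻¹) h2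
  rw [← Ad_mul, inv_mul_cancel, Ad_one, map_zero] at h3
  have h4 : (Θ (1 * b)).symm (F.e i) = 0 := h3
  exact F.e.ne_zero i ((Θ (1 * b)).symm.injective (h4.trans (map_zero _).symm))

/-- The projection of `𝔤` onto the span of the basis vectors of weight `χ`. -/
def BFiltration.weightProj (F : BFiltration Δ) (χ : H → ℂ) : Module.End ℂ (LieAlg E G) :=
  open Classical in F.e.constr ℂ fun i => if F.weight i = χ then F.e i else 0

open Classical in
theorem BFiltration.weightProj_basis (F : BFiltration Δ) (χ : H → ℂ)
    (i : Fin (Module.finrank ℂ (LieAlg E G))) :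
    F.weightProj χ (F.e i) = if F.weight i = χ then F.e i else 0 :=
  F.e.constr_basis ℂ _ i

theorem BFiltration.weightProj_mem (F : BFiltration Δ) (χ : H → ℂ) (x : LieAlg E G) :
    F.weightProj χ x ∈ rootSpace H χ := by
  rw [← F.e.sum_repr x, map_sum]
  refine Submodule.sum_mem (rootSpace H χ).toSubmodule fun i _ => ?_
  rw [map_smul, F.weightProj_basis]
  split_ifs with h
  · exact Submodule.smul_mem _ _ (h ▸ F.e_mem i)
  · rw [smul_zero]; exact Submodule.zero_mem _

/-- Both maps are diagonal in the basis `e`. -/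
theorem BFiltration.weightProj_gradedAction (F : BFiltration Δ) (χ : H → ℂ) (b : borel Δ)
    (x : LieAlg E G) :
    F.weightProj χ (F.gradedAction b x) = F.gradedAction b (F.weightProj χ x) := by
  have h : F.weightProj χ ∘ₗ F.gradedAction b = F.gradedAction b ∘ₗ F.weightProj χ := by
    refine F.e.ext fun i => ?_
    rw [LinearMap.comp_apply, LinearMap.comp_apply, F.gradedAction_basis, map_smul,
      F.weightProj_basis]
    split_ifs with h
    · rw [F.gradedAction_basis]
    · rw [smul_zero, map_zero]
  exact LinearMap.congr_fun h x

/-- An element acting by strictly triangular matrices is the sum of its negative root components. -/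
theorem BFiltration.sum_weightProj (F : BFiltration Δ) {a : LieAlg E G}
    (ha : ∀ j k, j ≤ k → F.e.coord k ⁅a, F.e j⁆ = 0) :
    ∑ α : NegRoot Δ, F.weightProj (α.1.1 : H → ℂ) a = a := by
  classical
  conv_rhs => rw [← F.e.sum_repr a]
  conv_lhs => rw [← F.e.sum_repr a]
  simp_rw [map_sum, map_smul, F.weightProj_basis]
  rw [Finset.sum_comm]
  refine Finset.sum_congr rfl fun i _ => ?_
  by_cases hi : F.e.coord i a = 0
  · have h0 : F.e.repr a i = 0 := hi
    simp [h0]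
  · obtain ⟨α, hα⟩ := F.exists_negRoot_of_coord_ne_zero ha hi
    rw [Finset.sum_eq_single α]
    · rw [if_pos hα]
    · intro β _ hβ
      rw [if_neg, smul_zero]
      intro h
      apply hβ
      apply Subtype.ext
      apply Subtype.ext
      exact DFunLike.coe_injective (h.symm.trans hα)
    · simp

end GradedAction

/-! ### Strictly upper-triangular matrices of forms and their root components -/

section UpperTriangular

open LieAlgebra LieAlgebra.IsKilling

variable {E : Type*} [NormedAddCommGroup E] [NormedSpace ℂ E] [FiniteDimensional ℂ E]
  [CompleteSpace E]
  {G : Type*} [TopologicalSpace G] [ChartedSpace E G] [Group G] [LieGroup 𝓘(ℂ, E) ω G]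
  [LieAlgebra.IsSimple ℂ (LieAlg E G)]
  {H : LieSubalgebra ℂ (LieAlg E G)} [H.IsCartanSubalgebra]
  {Δ : (LieAlgebra.IsKilling.rootSystem H).Base} {F : BFiltration Δ}

/-- The strictly upper-triangular endomorphism of `𝔤` with the entries `φ i j p X`. -/
def upperPart (φ : (i j : Fin (Module.finrank ℂ (LieAlg E G))) →
      Form01 (borelSubalgebra Δ) (F.homAction i j)) (p : G) (X : LieAlg E G) :
    Module.End ℂ (LieAlg E G) :=
  ∑ i, ∑ j ∈ Finset.Ioi i, φ i j p X • (F.e.coord j).smulRight (F.e i)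

variable (φ : (i j : Fin (Module.finrank ℂ (LieAlg E G))) →
  Form01 (borelSubalgebra Δ) (F.homAction i j))

theorem upperPart_apply (p : G) (X v : LieAlg E G) :
    upperPart φ p X v =
      ∑ i, ∑ j ∈ Finset.Ioi i, (φ i j p X * F.e.coord j v) • F.e i := by
  simp [upperPart, smul_smul]

theorem upperPart_basis (p : G) (X : LieAlg E G) (k : Fin (Module.finrank ℂ (LieAlg E G))) :
    upperPart φ p X (F.e k) = ∑ i, if i < k then φ i k p X • F.e i else 0 := by
  rw [upperPart_apply]
  refine Finset.sum_congr rfl fun i _ => ?_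
  split_ifs with h
  · rw [Finset.sum_eq_single k]
    · simp
    · intro j _ hj
      simp [Ne.symm hj]
    · intro hk
      exact absurd (Finset.mem_Ioi.mpr h) hk
  · refine Finset.sum_eq_zero fun j hj => ?_
    have hjk : k ≠ j := by
      rintro rfl
      exact h (Finset.mem_Ioi.mp hj)
    simp [hjk]

theorem coord_upperPart_basis (p : G) (X : LieAlg E G)
    {j k : Fin (Module.finrank ℂ (LieAlg E G))} (hjk : j ≤ k) :
    F.e.coord k (upperPart φ p X (F.e j)) = 0 := by
  rw [upperPart_basis, map_sum]
  refine Finset.sum_eq_zero fun i _ => ?_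
  split_ifs with h
  · have hik : i ≠ k := (h.trans_le hjk).ne
    simp [hik]
  · simp

theorem upperPart_add (p : G) (X Y : LieAlg E G) :
    upperPart φ p (X + Y) = upperPart φ p X + upperPart φ p Y := by
  simp only [upperPart, map_add, add_smul, Finset.sum_add_distrib]

theorem upperPart_smul (p : G) (c : ℂ) (X : LieAlg E G) :
    upperPart φ p (c • X) = (starRingEnd ℂ) c • upperPart φ p X := by
  simp only [upperPart, LinearMap.map_smulₛₗ, smul_eq_mul, mul_smul, Finset.smul_sum]

theorem upperPart_eq_zero (p : G) {X : LieAlg E G} (hX : X ∈ borelSubalgebra Δ) :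
    upperPart φ p X = 0 := by
  simp [upperPart, (φ _ _).horizontal p X hX]

/-- The factor `χ_i χ_j⁻¹` in the equivariance of `φ i j` is what conjugation by the diagonal graded
action does to entry `(i, j)`. -/
theorem gradedAction_upperPart (Θ : F.SmoothSplitting) (p : G) (b : borel Δ) (X v : LieAlg E G) :
    F.gradedAction b (upperPart φ (p * b) X v) =
      upperPart φ p (Ad (b : G) X) (F.gradedAction b v) := by
  have h : F.gradedAction b ∘ₗ upperPart φ (p * b) X =
      upperPart φ p (Ad (b : G) X) ∘ₗ F.gradedAction b := by
    refine F.e.ext fun k => ?_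
    rw [LinearMap.comp_apply, LinearMap.comp_apply, F.gradedAction_basis, map_smul,
      upperPart_basis, upperPart_basis, map_sum, Finset.smul_sum]
    refine Finset.sum_congr rfl fun i _ => ?_
    split_ifs with hik
    · have h1 : (F.char i b * (F.char k b)⁻¹) * φ i k (p * b) X = φ i k p (Ad (b : G) X) :=
        (φ i k).equivariant p b X
      rw [map_smul, F.gradedAction_basis, ← h1, smul_smul, smul_smul]
      congr 1
      field_simp [Θ.char_ne_zero b k]
    · rw [map_zero, smul_zero]
  exact LinearMap.congr_fun h v

/-- Stated for an arbitrary linear `T`, so as to apply to a left inverse of `ad` followed by a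
weight projection. -/
theorem isSmooth_upperPart {V : Type*} [AddCommGroup V] [Module ℂ V]
    (T : Module.End ℂ (LieAlg E G) →ₗ[ℂ] V) (X : LieAlg E G) :
    IsSmooth (E := E) (fun p => T (upperPart φ p X)) := by
  intro ℓ
  have h : (fun p : G => ℓ (T (upperPart φ p X))) = fun p => ∑ i, ∑ j ∈ Finset.Ioi i,
      φ i j p X * ℓ (T ((F.e.coord j).smulRight (F.e i))) := by
    funext p
    simp only [upperPart, map_sum, map_smul, smul_eq_mul]
  rw [h]
  exact contMDiff_finsetSum fun i _ => contMDiff_finsetSum fun j _ =>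
    contMDiff_mul_complex ((φ i j).smooth X LinearMap.id) contMDiff_const

/-- If `ad (L (upperPart φ p X)) = upperPart φ p X` for a linear map `L`, then the elements
`L (upperPart φ p X)` are equivariant. -/
theorem gradedAction_of_ad_eq (Θ : F.SmoothSplitting)
    (L : Module.End ℂ (LieAlg E G) →ₗ[ℂ] LieAlg E G)
    (hL : ∀ (p : G) (X v : LieAlg E G), ⁅L (upperPart φ p X), v⁆ = upperPart φ p X v)
    (p : G) (b : borel Δ) (X : LieAlg E G) :
    F.gradedAction b (L (upperPart φ (p * b) X)) = L (upperPart φ p (Ad (b : G) X)) := by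
  rw [← sub_eq_zero]
  -- The difference commutes with every `e k`, hence is central. Each `e k` is rewritten as a
  -- multiple of its image under the graded action, so that `gradedAction_lie` applies.
  have h : ∀ k, ⁅F.gradedAction b (L (upperPart φ (p * b) X)) -
      L (upperPart φ p (Ad (b : G) X)), F.e k⁆ = 0 := by
    intro k
    have h1 : F.e k = (F.char k b)⁻¹ • F.gradedAction b (F.e k) := by
      rw [F.gradedAction_basis, smul_smul, inv_mul_cancel₀ (Θ.char_ne_zero b k), one_smul]
    rw [h1, lie_smul, sub_lie, ← Θ.gradedAction_lie, hL, hL, gradedAction_upperPart φ Θ, sub_self,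
      smul_zero]
  set z := F.gradedAction b (L (upperPart φ (p * b) X)) - L (upperPart φ p (Ad (b : G) X))
  have h1 : z ∈ LieAlgebra.center ℂ (LieAlg E G) := by
    rw [LieModule.mem_maxTrivSubmodule]
    intro x
    rw [← F.e.sum_repr x, sum_lie]
    refine Finset.sum_eq_zero fun j _ => ?_
    rw [smul_lie, ← lie_skew, h, neg_zero, smul_zero]
  simpa using h1

theorem weightProj_equivariant (Θ : F.SmoothSplitting)
    (L : Module.End ℂ (LieAlg E G) →ₗ[ℂ] LieAlg E G)
    (hL : ∀ (p : G) (X v : LieAlg E G), ⁅L (upperPart φ p X), v⁆ = upperPart φ p X v)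
    (χ : H → ℂ) (p : G) (b : borel Δ) (X : LieAlg E G) :
    F.gradedAction b (F.weightProj χ (L (upperPart φ (p * b) X))) =
      F.weightProj χ (L (upperPart φ p (Ad (b : G) X))) := by
  rw [← F.weightProj_gradedAction, gradedAction_of_ad_eq φ Θ L hL]

/-- The conjugate-linear map `X ↦ T (upperPart φ p X)`. -/
def upperPartMap {V : Type*} [AddCommGroup V] [Module ℂ V]
    (T : Module.End ℂ (LieAlg E G) →ₗ[ℂ] V) (p : G) : LieAlg E G →ₗ⋆[ℂ] V where
  toFun X := T (upperPart φ p X)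
  map_add' X Y := by rw [upperPart_add, map_add]
  map_smul' c X := by rw [upperPart_smul, map_smul]

theorem upperPartMap_apply {V : Type*} [AddCommGroup V] [Module ℂ V]
    (T : Module.End ℂ (LieAlg E G) →ₗ[ℂ] V) (p : G) (X : LieAlg E G) :
    upperPartMap φ T p X = T (upperPart φ p X) := rfl

theorem upperPartMap_eq_zero {V : Type*} [AddCommGroup V] [Module ℂ V]
    (T : Module.End ℂ (LieAlg E G) →ₗ[ℂ] V) (p : G) {X : LieAlg E G}
    (hX : X ∈ borelSubalgebra Δ) : upperPartMap φ T p X = 0 := by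
  rw [upperPartMap_apply, upperPart_eq_zero φ p hX, map_zero]

/-- The root forms of an upper-triangular family of inner derivations. -/
def rootForm (Θ : F.SmoothSplitting)
    (L : Module.End ℂ (LieAlg E G) →ₗ[ℂ] LieAlg E G)
    (hL : ∀ (p : G) (X v : LieAlg E G), ⁅L (upperPart φ p X), v⁆ = upperPart φ p X v)
    (α : NegRoot Δ) : F.RootForm α where
  toFun p := upperPartMap φ (F.weightProj (α.1.1 : H → ℂ) ∘ₗ L) p
  smooth X := isSmooth_upperPart φ (F.weightProj (α.1.1 : H → ℂ) ∘ₗ L) X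
  horizontal p X hX := upperPartMap_eq_zero φ _ p hX
  equivariant p b X := weightProj_equivariant φ Θ L hL _ p b X
  mem_space p X := F.weightProj_mem (α.1.1 : H → ℂ) (L (upperPart φ p X))

end UpperTriangular

end FlagBundle

end

/-! ### The main theorem -/

open FlagBundle in
theorem proposition6 {E : Type*} [NormedAddCommGroup E] [NormedSpace ℂ E]
    [FiniteDimensional ℂ E] [CompleteSpace E]
    {G : Type*} [TopologicalSpace G] [ChartedSpace E G] [Group G] [LieGroup 𝓘(ℂ, E) ω G]
    [ConnectedSpace G] [LieAlgebra.IsSimple ℂ (LieAlg E G)]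
    (H : LieSubalgebra ℂ (LieAlg E G)) [H.IsCartanSubalgebra]
    (Δ : (LieAlgebra.IsKilling.rootSystem H).Base) (hADE : Δ.cartanMatrix.IsSimplyLaced)
    (F : BFiltration Δ) (Θ : F.SmoothSplitting)
    (D : SmoothSection E (adAction Δ) → Form01 (borelSubalgebra Δ) (adAction Δ))
    (hD : IsUpperTriangular Θ D) :
    PreservesBracket D ↔
      ∃ φ : (α : NegRoot Δ) → F.RootForm α,
        ∀ (s : SmoothSection E (adAction Δ)) (p : G) (X : LieAlg E G),
          Θ p (D s p X) = F.dbarZero (fun q => Θ q (s q)) p X +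
            ∑ α : NegRoot Δ, ⁅(φ α).toFun p X, Θ p (s p)⁆ := by
  constructor
  · intro hpres
    obtain ⟨φ, hφ⟩ := hD
    have hder := (preservesBracket_iff Θ D (upperPart φ) fun s p X => by
      rw [hφ, upperPart_apply]).mp hpres
    have hinj : Function.Injective
        (LieAlgebra.ad ℂ (LieAlg E G) : LieAlg E G →ₗ[ℂ] Module.End ℂ (LieAlg E G)) := by
      intro x y hxy
      rw [← sub_eq_zero]
      have h1 : x - y ∈ LieAlgebra.center ℂ (LieAlg E G) := by
        rw [LieModule.mem_maxTrivSubmodule]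
        intro z
        have h2 : ⁅x, z⁆ = ⁅y, z⁆ := LinearMap.congr_fun hxy z
        rw [← lie_skew, sub_lie, h2, sub_self, neg_zero]
      simpa using h1
    -- Choosing one linear left inverse of `ad`, independent of `p` and `X`, makes the element
    -- representing the derivation a linear function of the matrix.
    obtain ⟨L, hL⟩ := LinearMap.exists_leftInverse_of_injective _ (LinearMap.ker_eq_bot.mpr hinj)
    have hLA : ∀ (p : G) (X v : LieAlg E G), ⁅L (upperPart φ p X), v⁆ = upperPart φ p X v := by
      intro p X v
      let d : LieDerivation ℂ (LieAlg E G) (LieAlg E G) :=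
        { toLinearMap := upperPart φ p X
          leibniz' := fun u w => by
            -- The Leibniz rule of `LieDerivation` has the form `⁅u, d w⁆ - ⁅w, d u⁆`.
            rw [hder p X u w, ← lie_skew w, sub_neg_eq_add, add_comm] }
      obtain ⟨a, ha⟩ := LieDerivation.IsKilling.exists_eq_ad d
      have h1 : LieAlgebra.ad ℂ (LieAlg E G) a = upperPart φ p X := by
        ext w
        rw [LieAlgebra.ad_apply, ← LieDerivation.ad_apply_apply ℂ, ha]
        rfl
      have h2 : L (upperPart φ p X) = a := by
        rw [← h1]
        exact LinearMap.congr_fun hL a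
      rw [h2, ← h1, LieAlgebra.ad_apply]
    refine ⟨rootForm φ Θ L hLA, fun s p X => ?_⟩
    rw [hφ, ← upperPart_apply, ← sum_lie]
    -- The sum of the negative root components recovers the whole element, because its adjoint
    -- action is strictly triangular.
    have h1 : ∑ α : NegRoot Δ, (rootForm φ Θ L hLA α).toFun p X = L (upperPart φ p X) :=
      F.sum_weightProj fun j k hjk => by
        rw [hLA, coord_upperPart_basis φ p X hjk]
    rw [h1, hLA]
  · rintro ⟨φ, hφ⟩
    refine (preservesBracket_iff Θ D
      (fun p X => LieAlgebra.ad ℂ (LieAlg E G) (∑ α : NegRoot Δ, (φ α).toFun p X))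
      fun s p X => ?_).mpr fun p X u v => ?_
    · rw [hφ, LieAlgebra.ad_apply, sum_lie]
    · simp only [LieAlgebra.ad_apply]
      exact leibniz_lie _ _ _
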